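/- Let $t\ge 1$. An instance of \textsc{$t$-Uniform Set Cover} consists of a finite universe $U$ with $n=|U|$, a family $\mathcal S$ of subsets of $U$ that contains every $t$-element subset of $U$ (and possibly other subsets of $U$ of any sizes), and an integer parameter $k\ge 0$; the question is whether $U$ is the union of at most $\lceil n/t\rceil-k$ sets of $\mathcal S$. **Theorem.** There is a deterministic algorithm (a random access machine program that uses addition and truncated subtraction as its only arithmetic, with unit cost per instruction) which, given $t\geq 1$ and an instance of \textsc{$t$-Uniform Set Cover}, decides correctly whether such a cover exists, and whose running time, for constant $t$, is $2^{O(k)}\,\mathrm{poly}(n)$. That is, for every $t\ge 1$ there is a constant $C$, depending only on $t$, such that on all instances the algorithm halts after at most $C\cdot 2^{Ck}\cdot (n+1)^{C}$ steps. Here the universe is given as $\{0,\dots,n-1\}$, and $\mathcal S$ is given by its size and the incidence matrix of its members, listed without repetition in any order, in random access memory. -/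

import Mathlib

/-! ### The machine model: random access machine programs with unit cost

A program works on finitely many registers and finitely many arrays, all holding natural numbers.
The only arithmetic is addition and (truncated) subtraction; every instruction and every test costs
one step. Without multiplication and shifts a number has at most linearly many bits in the number
of steps (beyond those of the input), so that this unit-cost measure is polynomially related to
the running time of Turing machines. -/

namespace RAM

/-- A memory state: `var x` is the content of register `x`, and `arr a i` is entry `i` of
array `a`. -/
@[ext] structure State where
  var : ℕ → ℕ
  arr : ℕ → ℕ → ℕ

/-- Assign the value `v` to register `x`. -/
def State.setVar (s : State) (x v : ℕ) : State where
  var := Function.update s.var x v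
  arr := s.arr

/-- Assign the value `v` to entry `i` of array `a`. -/
def State.setArr (s : State) (a i v : ℕ) : State where
  var := s.var
  arr := Function.update s.arr a (Function.update (s.arr a) i v)

/-- Programs. Register names, array names and constants are part of the program text. -/
inductive Prog where
  /-- register `x` := the constant `c` -/
  | const (x c : ℕ)
  /-- register `x` := register `y` + register `z` -/
  | add (x y z : ℕ)
  /-- register `x` := max (register `y` - register `z`) 0 -/
  | sub (x y z : ℕ)
  /-- register `x` := entry (register `i`) of array `a` -/
  | load (x a i : ℕ)
  /-- entry (register `i`) of array `a` := register `x` -/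
  | store (a i x : ℕ)
  /-- first `p`, then `q` -/
  | seq (p q : Prog)
  /-- if register `x` is nonzero then `p`, else `q` -/
  | ite (x : ℕ) (p q : Prog)
  /-- while register `x` is nonzero do `p` -/
  | loop (x : ℕ) (p : Prog)

/-- `Runs p s s' T`: started in the state `s`, the program `p` halts in the state `s'` after
exactly `T` steps. -/
inductive Runs : Prog → State → State → ℕ → Prop
  | const (s : State) (x c : ℕ) : Runs (.const x c) s (s.setVar x c) 1
  | add (s : State) (x y z : ℕ) : Runs (.add x y z) s (s.setVar x (s.var y + s.var z)) 1
  | sub (s : State) (x y z : ℕ) : Runs (.sub x y z) s (s.setVar x (s.var y - s.var z)) 1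
  | load (s : State) (x a i : ℕ) : Runs (.load x a i) s (s.setVar x (s.arr a (s.var i))) 1
  | store (s : State) (a i x : ℕ) : Runs (.store a i x) s (s.setArr a (s.var i) (s.var x)) 1
  | seq {p q : Prog} {s s₁ s₂ : State} {T₁ T₂ : ℕ} :
      Runs p s s₁ T₁ → Runs q s₁ s₂ T₂ → Runs (.seq p q) s s₂ (T₁ + T₂)
  | ite_ne {x : ℕ} {p q : Prog} {s s' : State} {T : ℕ} :
      s.var x ≠ 0 → Runs p s s' T → Runs (.ite x p q) s s' (T + 1)
  | ite_eq {x : ℕ} {p q : Prog} {s s' : State} {T : ℕ} :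
      s.var x = 0 → Runs q s s' T → Runs (.ite x p q) s s' (T + 1)
  | loop_ne {x : ℕ} {p : Prog} {s s₁ s₂ : State} {T₁ T₂ : ℕ} :
      s.var x ≠ 0 → Runs p s s₁ T₁ → Runs (.loop x p) s₁ s₂ T₂ →
        Runs (.loop x p) s s₂ (T₁ + T₂ + 1)
  | loop_eq {x : ℕ} {p : Prog} {s : State} :
      s.var x = 0 → Runs (.loop x p) s s 1

/-- Programs are deterministic: the final state and the number of steps are determined by the
program and the initial state. -/
theorem Runs.deterministic {p : Prog} {s s₁ s₂ : State} {T₁ T₂ : ℕ}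
    (h₁ : Runs p s s₁ T₁) (h₂ : Runs p s s₂ T₂) : s₁ = s₂ ∧ T₁ = T₂ := by
  induction h₁ generalizing s₂ T₂ with
  | const | add | sub | load | store => cases h₂; exact ⟨rfl, rfl⟩
  | seq _ _ ih ih' =>
    cases h₂ with
    | seq a b => obtain ⟨rfl, rfl⟩ := ih a; obtain ⟨rfl, rfl⟩ := ih' b; exact ⟨rfl, rfl⟩
  | ite_ne h _ ih =>
    cases h₂ with
    | ite_ne _ a => obtain ⟨rfl, rfl⟩ := ih a; exact ⟨rfl, rfl⟩
    | ite_eq h' _ => exact absurd h' h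
  | ite_eq h _ ih =>
    cases h₂ with
    | ite_ne h' _ => exact absurd h h'
    | ite_eq _ a => obtain ⟨rfl, rfl⟩ := ih a; exact ⟨rfl, rfl⟩
  | loop_ne h _ _ ih ih' =>
    cases h₂ with
    | loop_ne _ a b => obtain ⟨rfl, rfl⟩ := ih a; obtain ⟨rfl, rfl⟩ := ih' b; exact ⟨rfl, rfl⟩
    | loop_eq h' => exact absurd h' h
  | loop_eq h =>
    cases h₂ with
    | loop_ne h' _ _ => exact absurd h h'
    | loop_eq _ => exact ⟨rfl, rfl⟩

end RAM

/-! ### Uniform set cover -/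

namespace SetCover

/-- A set system over the universe `U` is `t`-uniform if every `t`-element subset of `U` is one of
its sets (further sets, of any sizes, are allowed). -/
def IsUniform {U : Type*} (t : ℕ) (𝒮 : Finset (Finset U)) : Prop :=
  ∀ A : Finset U, A.card = t → A ∈ 𝒮

/-- The universe is the union of at most `r` sets of the system `𝒮`. The number `r` is an integer;
there is no such cover if it is negative. -/
def HasCover {U : Type*} (𝒮 : Finset (Finset U)) (r : ℤ) : Prop :=
  ∃ 𝒞 ⊆ 𝒮, (∀ u : U, ∃ A ∈ 𝒞, u ∈ A) ∧ (𝒞.card : ℤ) ≤ r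

/-- The initial memory for the universe `{0, …, n - 1}`, the numbers `t` and `k`, and the sets
listed in `L`: registers 0, 1, 2, 3 hold `n`, `t`, `k` and the number of sets; array 0 holds the
incidence matrix, row by row (entry `i * n + j` is 1 if set number `i` contains the element `j`);
everything else is 0. -/
def input (t k n : ℕ) (L : List (Finset (Fin n))) : RAM.State where
  var x :=
    match x with
    | 0 => n
    | 1 => t
    | 2 => k
    | 3 => L.length
    | _ => 0
  arr a p :=
    if a = 0 ∧ ∃ i : Fin L.length, ∃ j : Fin n, p = i * n + j ∧ j ∈ L[i] then 1 else 0

end SetCover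

/-! Let `r` be the ceiling of n/t and suppose t ≤ n. Since every t-set is available, what a
subfamily F leaves uncovered can be finished off by t-sets. Hence a cover by r - k sets exists iff
some F satisfies |⋃F| ≥ D + t|F|, where D = n - t(r - k) ≤ tk (`hasCover_iff_hasSurplus`). A greedy
argument (`exists_greedy`) shows that F can be taken with at most D members
(`HasSurplus.exists_card_le`), so only D + t|F| ≤ Q = t(t+1)k elements of its union matter. It also
shows that a family without surplus has at most 2^(D+tD) (n+1)^t members
(`card_le_of_not_hasSurplus`). Therefore it suffices to look at a prefix of the list of that order,
although the list itself may have exponential length.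

The surplus is then found by derandomized color coding. Some coloring with c = 16Q + 8 colors, from
an explicit list of 2^O(Q) poly(n) colorings, is injective on the relevant elements
(`exists_coloring`). For each coloring, each j ≤ tk and each set C of at least D + tj colors,
inclusion-exclusion over the subsets of C decides whether some j sets show all colors of C
(`parityTerm_lt_iff`). A positive answer proves a surplus whatever the coloring is
(`Inst.hasSurplus_of_test`), so the seeds can be enumerated without checking primality or
injectivity. If n < t, at most one set is allowed and the list is searched directly.

The running time is obtained from a small calculus of functions computable in time polynomial in
`Inst.bd`, a quantity of the form 2^O(k) poly(n) for constant t. Closure under bounded iteration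
(`Ctx.Comp.iter`) yields sums, bounded quantifiers and arithmetic, and hence a program for
`Inst.Accepts`. -/

namespace UniformSetCover

open Finset RAM

/-! ### Functions computable in time polynomial in a given bound -/

/-- A context describes the memory available to a program: an element `γ` of `Γ` with `ok γ`
supplies the values `rep γ i` of the first `d` variables, the content `orc γ` of array 0, and a
bound `bd γ`, in terms of which running times are measured. -/
structure Ctx (Γ : Type) where
  d : ℕ
  rep : Γ → ℕ → ℕ
  orc : Γ → ℕ → ℕ
  bd : Γ → ℕ
  ok : Γ → Prop

namespace Ctx

variable {Γ : Type} {c : Ctx Γ}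

/-- `f` is bounded by a polynomial in the bound of the context. -/
def Poly (c : Ctx Γ) (f : Γ → ℕ) : Prop :=
  ∃ C, ∀ γ, c.ok γ → f γ ≤ C * (c.bd γ + 1) ^ C

/-- `f` is computable in polynomial time: for every placement `loc` of the variables in registers
below `e` some program leaves the value of `f` in register `e`, changing neither the registers
below `e` nor the arrays. -/
def Comp (c : Ctx Γ) (f : Γ → ℕ) : Prop :=
  ∀ (loc : ℕ → ℕ) (e : ℕ), (∀ i < c.d, loc i < e) → ∃ (P : Prog) (τ : Γ → ℕ), c.Poly τ ∧
    ∀ γ s, c.ok γ → (∀ i < c.d, s.var (loc i) = c.rep γ i) → s.arr 0 = c.orc γ →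
      ∃ s' T, Runs P s s' T ∧ T ≤ τ γ ∧ s'.var e = f γ ∧ (∀ x < e, s'.var x = s.var x) ∧
        s'.arr = s.arr

/-- The context extended by a variable whose value satisfies `R`. -/
def push (c : Ctx Γ) (R : Γ → ℕ → Prop) : Ctx (Γ × ℕ) where
  d := c.d + 1
  rep p i := if i = c.d then p.2 else c.rep p.1 i
  orc p := c.orc p.1
  bd p := c.bd p.1
  ok p := c.ok p.1 ∧ R p.1 p.2

/-- The context extended by a variable below `b`. -/
abbrev idx (c : Ctx Γ) (b : Γ → ℕ) : Ctx (Γ × ℕ) := c.push fun γ i => i < b γ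

/-- The context extended by an arbitrary variable. -/
abbrev acc (c : Ctx Γ) : Ctx (Γ × ℕ) := c.push fun _ _ => True

theorem Poly.mono {f g : Γ → ℕ} (hg : c.Poly g) (h : ∀ γ, c.ok γ → f γ ≤ g γ) : c.Poly f :=
  let ⟨C, hC⟩ := hg
  ⟨C, fun γ hγ => (h γ hγ).trans (hC γ hγ)⟩

theorem Poly.const (a : ℕ) : c.Poly fun _ => a :=
  ⟨a, fun _ _ => Nat.le_mul_of_pos_right _ (by positivity)⟩

theorem Poly.bd : c.Poly c.bd := ⟨1, fun _ _ => by simp⟩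

theorem Poly.mul {f g : Γ → ℕ} (hf : c.Poly f) (hg : c.Poly g) : c.Poly fun γ => f γ * g γ := by
  obtain ⟨C, hC⟩ := hf
  obtain ⟨D, hD⟩ := hg
  refine ⟨C * D + (C + D), fun γ hγ => ?_⟩
  calc f γ * g γ ≤ (C * (c.bd γ + 1) ^ C) * (D * (c.bd γ + 1) ^ D) :=
        Nat.mul_le_mul (hC γ hγ) (hD γ hγ)
    _ = (C * D) * (c.bd γ + 1) ^ (C + D) := by ring
    _ ≤ _ := Nat.mul_le_mul (by omega) (Nat.pow_le_pow_right (by omega) (by omega))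

theorem Poly.add {f g : Γ → ℕ} (hf : c.Poly f) (hg : c.Poly g) : c.Poly fun γ => f γ + g γ := by
  obtain ⟨C, hC⟩ := hf
  obtain ⟨D, hD⟩ := hg
  refine ⟨C + D, fun γ hγ => ?_⟩
  calc f γ + g γ ≤ C * (c.bd γ + 1) ^ C + D * (c.bd γ + 1) ^ D :=
        Nat.add_le_add (hC γ hγ) (hD γ hγ)
    _ ≤ C * (c.bd γ + 1) ^ (C + D) + D * (c.bd γ + 1) ^ (C + D) := by
        gcongr <;> omega
    _ = _ := by ring

theorem Poly.weak {f : Γ → ℕ} {R} (hf : c.Poly f) : (c.push R).Poly fun p => f p.1 :=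
  let ⟨C, hC⟩ := hf
  ⟨C, fun p hp => hC p.1 hp.1⟩

theorem Poly.idx {b : Γ → ℕ} (hb : c.Poly b) : (c.idx b).Poly fun p => p.2 :=
  hb.weak.mono fun _ h => h.2.le

theorem Comp.congr {f g : Γ → ℕ} (hf : c.Comp f) (h : ∀ γ, c.ok γ → f γ = g γ) : c.Comp g := by
  intro loc e he
  obtain ⟨P, τ, hτ, H⟩ := hf loc e he
  refine ⟨P, τ, hτ, fun γ s h1 h2 h3 => ?_⟩
  obtain ⟨s', T, a1, a2, a3, a4⟩ := H γ s h1 h2 h3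
  exact ⟨s', T, a1, a2, a3.trans (h γ h1), a4⟩

theorem Comp.const (a : ℕ) : c.Comp fun _ => a := fun _ e _ =>
  ⟨.const e a, fun _ => 1, .const 1, fun _ s _ _ _ =>
    ⟨_, _, .const s e a, le_rfl, by simp [State.setVar],
      fun x hx => by simp [State.setVar, hx.ne], rfl⟩⟩

theorem Comp.var {i : ℕ} (hi : i < c.d) : c.Comp fun γ => c.rep γ i := fun loc e he =>
  ⟨.seq (.const e 0) (.add e (loc i) e), fun _ => 2, .const 2, fun γ s _ h _ =>
    ⟨_, _, .seq (.const s e 0) (.add _ e (loc i) e), le_rfl,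
      by simp [State.setVar, (he i hi).ne, h i hi],
      fun x hx => by simp [State.setVar, hx.ne], rfl⟩⟩

theorem Comp.weak {f : Γ → ℕ} {R} (hf : c.Comp f) : (c.push R).Comp fun p => f p.1 := by
  intro loc e he
  obtain ⟨P, τ, hτ, H⟩ := hf loc e fun i hi => he i (Nat.lt_succ_of_lt hi)
  refine ⟨P, fun p => τ p.1, hτ.weak, fun p s h1 h2 h3 => H p.1 s h1.1 (fun i hi => ?_) h3⟩
  rw [h2 i (Nat.lt_succ_of_lt hi)]
  simp [push, hi.ne]

theorem Comp.top {R} : (c.push R).Comp fun p => p.2 :=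
  (Comp.var (c := c.push R) (i := c.d) (Nat.lt_succ_self _)).congr fun _ _ => by simp [push]

theorem Comp.load {f : Γ → ℕ} (hf : c.Comp f) : c.Comp fun γ => c.orc γ (f γ) := by
  intro loc e he
  obtain ⟨P, τ, hτ, H⟩ := hf loc e he
  refine ⟨.seq P (.load e 0 e), fun γ => τ γ + 1, hτ.add (.const 1), fun γ s h1 h2 h3 => ?_⟩
  obtain ⟨s', T, a1, a2, a3, a4, a5⟩ := H γ s h1 h2 h3
  refine ⟨_, _, .seq a1 (.load s' e 0 e), by dsimp only; omega, ?_, fun x hx => ?_, a5⟩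
  · simp [State.setVar, a3, a5, h3]
  · simp [State.setVar, hx.ne, a4 x hx]

/-- Computing two functions one after the other. -/
theorem Comp.both {f g : Γ → ℕ} (hf : c.Comp f) (hg : c.Comp g) (loc : ℕ → ℕ) (e : ℕ)
    (he : ∀ i < c.d, loc i < e) : ∃ (P : Prog) (τ : Γ → ℕ), c.Poly τ ∧
    ∀ γ s, c.ok γ → (∀ i < c.d, s.var (loc i) = c.rep γ i) → s.arr 0 = c.orc γ →
      ∃ s' T, Runs P s s' T ∧ T ≤ τ γ ∧ s'.var e = f γ ∧ s'.var (e + 1) = g γ ∧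
        (∀ x < e, s'.var x = s.var x) ∧ s'.arr = s.arr := by
  obtain ⟨P, τ, hτ, H⟩ := hf loc e he
  obtain ⟨P', τ', hτ', H'⟩ := hg loc (e + 1) fun i hi => (he i hi).trans (Nat.lt_succ_self e)
  refine ⟨.seq P P', fun γ => τ γ + τ' γ, hτ.add hτ', fun γ s h1 h2 h3 => ?_⟩
  obtain ⟨s₁, T₁, a1, a2, a3, a4, a5⟩ := H γ s h1 h2 h3
  obtain ⟨s₂, T₂, b1, b2, b3, b4, b5⟩ := H' γ s₁ h1
    (fun i hi => by rw [a4 _ (he i hi), h2 i hi]) (by rw [a5, h3])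
  exact ⟨s₂, _, .seq a1 b1, by dsimp only; omega, by rw [b4 e (by omega), a3], b3,
    fun x hx => by rw [b4 x (by omega), a4 x hx], by rw [b5, a5]⟩

theorem Comp.add {f g : Γ → ℕ} (hf : c.Comp f) (hg : c.Comp g) : c.Comp fun γ => f γ + g γ := by
  intro loc e he
  obtain ⟨P, τ, hτ, H⟩ := hf.both hg loc e he
  refine ⟨.seq P (.add e e (e + 1)), fun γ => τ γ + 1, hτ.add (.const 1), fun γ s h1 h2 h3 => ?_⟩
  obtain ⟨s', T, a1, a2, a3, a4, a5, a6⟩ := H γ s h1 h2 h3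
  refine ⟨_, _, .seq a1 (.add s' e e (e + 1)), by dsimp only; omega, ?_, fun x hx => ?_, a6⟩
  · simp [State.setVar, a3, a4]
  · simp [State.setVar, hx.ne, a5 x hx]

theorem Comp.sub {f g : Γ → ℕ} (hf : c.Comp f) (hg : c.Comp g) : c.Comp fun γ => f γ - g γ := by
  intro loc e he
  obtain ⟨P, τ, hτ, H⟩ := hf.both hg loc e he
  refine ⟨.seq P (.sub e e (e + 1)), fun γ => τ γ + 1, hτ.add (.const 1), fun γ s h1 h2 h3 => ?_⟩
  obtain ⟨s', T, a1, a2, a3, a4, a5, a6⟩ := H γ s h1 h2 h3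
  refine ⟨_, _, .seq a1 (.sub s' e e (e + 1)), by dsimp only; omega, ?_, fun x hx => ?_, a6⟩
  · simp [State.setVar, a3, a4]
  · simp [State.setVar, hx.ne, a5 x hx]

theorem Comp.iteZero {f g h : Γ → ℕ} (hf : c.Comp f) (hg : c.Comp g) (hh : c.Comp h) :
    c.Comp fun γ => if f γ = 0 then g γ else h γ := by
  intro loc e he
  obtain ⟨P, τ, hτ, H⟩ := hf loc e he
  obtain ⟨Pg, τg, hτg, Hg⟩ := hg loc e he
  obtain ⟨Ph, τh, hτh, Hh⟩ := hh loc e he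
  refine ⟨.seq P (.ite e Ph Pg), fun γ => τ γ + (τg γ + τh γ + 1),
    hτ.add ((hτg.add hτh).add (.const 1)), fun γ s h1 h2 h3 => ?_⟩
  obtain ⟨s₁, T₁, a1, a2, a3, a4, a5⟩ := H γ s h1 h2 h3
  have h2' : ∀ i < c.d, s₁.var (loc i) = c.rep γ i := fun i hi => by rw [a4 _ (he i hi), h2 i hi]
  have h3' : s₁.arr 0 = c.orc γ := by rw [a5, h3]
  by_cases h0 : f γ = 0
  · obtain ⟨s₂, T₂, b1, b2, b3, b4, b5⟩ := Hg γ s₁ h1 h2' h3'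
    exact ⟨s₂, _, .seq a1 (.ite_eq (by rw [a3, h0]) b1), by dsimp only; omega, by simp [b3, h0],
      fun x hx => by rw [b4 x hx, a4 x hx], by rw [b5, a5]⟩
  · obtain ⟨s₂, T₂, b1, b2, b3, b4, b5⟩ := Hh γ s₁ h1 h2' h3'
    exact ⟨s₂, _, .seq a1 (.ite_ne (by rwa [a3]) b1), by dsimp only; omega, by simp [b3, h0],
      fun x hx => by rw [b4 x hx, a4 x hx], by rw [b5, a5]⟩

/-- The body is polynomial for all values of the accumulator at once, because the bound of an
extended context ignores the added variables. Accumulators may therefore outgrow every polynomial in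
the bound, as the powers in inclusion-exclusion do; only the number of rounds must be bounded. -/
theorem Comp.iter {b z : Γ → ℕ} {g : Γ → ℕ → ℕ → ℕ} (hb : c.Comp b) (pb : c.Poly b)
    (hz : c.Comp z) (hg : (c.idx b).acc.Comp fun p => g p.1.1 p.1.2 p.2) :
    c.Comp fun γ => Nat.rec (z γ) (g γ) (b γ) := by
  intro loc e he
  obtain ⟨Pz, τz, hτz, Hz⟩ := hz loc e he
  obtain ⟨Pb, τb, hτb, Hb⟩ := hb loc (e + 2) fun i hi => (he i hi).trans (by omega)
  obtain ⟨Pg, τg, ⟨C, hC⟩, Hg⟩ := hg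
    (fun i => if i = c.d + 1 then e else if i = c.d then e + 1 else loc i) (e + 4) (by
      intro i hi
      have hi : i < c.d + 1 + 1 := hi
      split_ifs with h1 h2
      · omega
      · omega
      · exact (he i (by omega)).trans (by omega))
  -- Register `e` holds the accumulator, `e + 1` the index, `e + 2` the number of rounds left, `e +
  -- 3` the constant 1, `e + 4` the new value, and `e + 5` a zero used for copying.
  let body : Prog := .seq Pg (.seq (.const (e + 5) 0) (.seq (.add e (e + 4) (e + 5))
    (.seq (.add (e + 1) (e + 1) (e + 3)) (.sub (e + 2) (e + 2) (e + 3)))))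
  refine ⟨.seq Pz (.seq (.const (e + 1) 0) (.seq Pb (.seq (.const (e + 3) 1)
    (.loop (e + 2) body)))),
    fun γ => τz γ + (1 + (τb γ + (1 + (b γ * (C * (c.bd γ + 1) ^ C + 5) + 1)))),
    hτz.add ((Poly.const 1).add (hτb.add ((Poly.const 1).add
      ((pb.mul (Poly.add ⟨C, fun γ _ => le_rfl⟩ (.const 5))).add (.const 1))))),
    fun γ s h1 h2 h3 => ?_⟩
  have key : ∀ m i s, i + m = b γ → s.var e = Nat.rec (z γ) (g γ) i → s.var (e + 1) = i →
      s.var (e + 2) = m → s.var (e + 3) = 1 → (∀ i < c.d, s.var (loc i) = c.rep γ i) →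
      s.arr 0 = c.orc γ → ∃ s' T, Runs (.loop (e + 2) body) s s' T ∧
        T ≤ m * (C * (c.bd γ + 1) ^ C + 5) + 1 ∧ s'.var e = Nat.rec (z γ) (g γ) (b γ) ∧
        (∀ x < e, s'.var x = s.var x) ∧ s'.arr = s.arr := by
    intro m
    induction m with
    | zero =>
      intro i s hi hv _ h0 _ _ _
      obtain rfl : i = b γ := by omega
      exact ⟨s, 1, .loop_eq h0, by omega, hv, fun _ _ => rfl, rfl⟩
    | succ m ih =>
      intro i s hi hv hi' hm h1' hloc harr
      have hok : (c.idx b).acc.ok ((γ, i), s.var e) := ⟨⟨h1, show i < b γ by omega⟩, trivial⟩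
      obtain ⟨s₁, T₁, a1, a2, a3, a4, a5⟩ := Hg ((γ, i), s.var e) s hok (by
        intro j hj
        have hj : j < c.d + 1 + 1 := hj
        by_cases hj1 : j = c.d + 1
        · simp [push, hj1]
        · by_cases hj2 : j = c.d
          · simp [push, hj2, hi']
          · simp [push, hj1, hj2, hloc j (by omega)]) harr
      have q1 := a4 (e + 1) (by omega)
      have q2 := a4 (e + 2) (by omega)
      have q3 := a4 (e + 3) (by omega)
      obtain ⟨s₂, hbody, w0, w1, w2, w3, w4, w5⟩ : ∃ s₂, Runs body s s₂ (T₁ + (1 + (1 + (1 + 1)))) ∧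
          s₂.var e = g γ i (s.var e) ∧ s₂.var (e + 1) = i + 1 ∧ s₂.var (e + 2) = m ∧
          s₂.var (e + 3) = 1 ∧ (∀ x < e, s₂.var x = s.var x) ∧ s₂.arr = s.arr :=
        ⟨_, .seq a1 (.seq (.const s₁ (e + 5) 0) (.seq (.add _ e (e + 4) (e + 5))
          (.seq (.add _ (e + 1) (e + 1) (e + 3)) (.sub _ (e + 2) (e + 2) (e + 3))))),
          by simp [State.setVar, a3], by simp [State.setVar, q1, q3, hi', h1'],
          by simp [State.setVar, q2, q3, hm, h1'], by simp [State.setVar, q3, h1'],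
          fun x hx => by
            rw [← a4 x (by omega)]
            simp [State.setVar, show x ≠ e by omega, show x ≠ e + 1 by omega,
              show x ≠ e + 2 by omega, show x ≠ e + 5 by omega], a5⟩
      obtain ⟨s', T, r1, r2, r3, r4, r5⟩ := ih (i + 1) s₂ (by omega) (by rw [w0, hv]) w1 w2 w3
        (fun j hj => by rw [w4 _ (he j hj), hloc j hj]) (by rw [w5, harr])
      have hC' := hC _ hok
      simp only [push] at hC'
      refine ⟨s', _, .loop_ne (by omega) hbody r1, ?_, r3, fun x hx => by rw [r4 x hx, w4 x hx],
        by rw [r5, w5]⟩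
      rw [Nat.succ_mul]
      omega
  obtain ⟨s₁, T₁, a1, a2, a3, a4, a5⟩ := Hz γ s h1 h2 h3
  have b0 : Runs (.const (e + 1) 0) s₁ _ 1 := .const s₁ (e + 1) 0
  obtain ⟨s₂, T₂, b1, b2, b3, b4, b5⟩ := Hb γ (s₁.setVar (e + 1) 0) h1 (fun i hi => by
    have := he i hi
    rw [← h2 i hi, ← a4 _ this]
    simp [State.setVar, show loc i ≠ e + 1 by omega])
    (by simp only [State.setVar]; rw [a5, h3])
  obtain ⟨s₃, T₃, c1, c2, c3, c4, c5⟩ := key (b γ) 0 (s₂.setVar (e + 3) 1) (by omega)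
    (by simp [State.setVar, b4, a3]) (by simp [State.setVar, b4]) (by simp [State.setVar, b3])
    (by simp [State.setVar])
    (fun i hi => by
      have := he i hi
      rw [← h2 i hi, ← a4 _ this]
      simp [State.setVar, show loc i ≠ e + 1 by omega,
        show loc i ≠ e + 3 by omega, b4 (loc i) (by omega)])
    (by simp only [State.setVar]; rw [b5, State.setVar, a5, h3])
  refine ⟨s₃, _, .seq a1 (.seq b0 (.seq b1 (.seq (.const s₂ (e + 3) 1) c1))), ?_, c3,
    fun x hx => ?_, ?_⟩
  · dsimp only; omega
  · rw [c4 x hx, ← a4 x hx]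
    simp [State.setVar, show x ≠ e + 3 by omega,
      show x ≠ e + 1 by omega, b4 x (by omega)]
  · rw [c5, State.setVar, b5, State.setVar, a5]

end Ctx

/-! ### Decidable predicates, bounded sums and quantifiers, arithmetic -/

namespace Ctx

variable {Γ : Type} {c : Ctx Γ}

open Classical in
/-- `p` is decidable in polynomial time. -/
def Dec (c : Ctx Γ) (p : Γ → Prop) : Prop := c.Comp fun γ => if p γ then 1 else 0

open Classical in
theorem Dec.congr {p q : Γ → Prop} (hp : c.Dec p) (h : ∀ γ, c.ok γ → (p γ ↔ q γ)) : c.Dec q :=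
  Comp.congr hp fun γ hγ => if_congr (h γ hγ) rfl rfl

theorem Dec.weak {p : Γ → Prop} {R} (hp : c.Dec p) : (c.push R).Dec fun x => p x.1 :=
  Comp.weak hp

theorem Comp.eqZero {f : Γ → ℕ} (hf : c.Comp f) : c.Dec fun γ => f γ = 0 :=
  (hf.iteZero (.const 1) (.const 0)).congr fun _ _ => by split_ifs <;> rfl

open Classical in
theorem Comp.ite {p : Γ → Prop} {f g : Γ → ℕ} (hp : c.Dec p) (hf : c.Comp f) (hg : c.Comp g) :
    c.Comp fun γ => if p γ then f γ else g γ :=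
  (Comp.iteZero hp hg hf).congr fun γ _ => by by_cases h : p γ <;> simp [h]

theorem Dec.not {p : Γ → Prop} (hp : c.Dec p) : c.Dec fun γ => ¬ p γ :=
  (Comp.eqZero hp).congr fun γ _ => by simp

theorem Dec.and {p q : Γ → Prop} (hp : c.Dec p) (hq : c.Dec q) : c.Dec fun γ => p γ ∧ q γ :=
  (Comp.ite hp hq (.const 0)).congr fun γ _ => by split_ifs <;> tauto

theorem Dec.or {p q : Γ → Prop} (hp : c.Dec p) (hq : c.Dec q) : c.Dec fun γ => p γ ∨ q γ :=
  (hp.not.and hq.not).not.congr fun γ _ => by tauto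

theorem Dec.imp {p q : Γ → Prop} (hp : c.Dec p) (hq : c.Dec q) : c.Dec fun γ => p γ → q γ :=
  (hp.not.or hq).congr fun γ _ => by tauto

theorem Comp.le {f g : Γ → ℕ} (hf : c.Comp f) (hg : c.Comp g) : c.Dec fun γ => f γ ≤ g γ :=
  (hf.sub hg).eqZero.congr fun _ _ => by omega

theorem Comp.lt {f g : Γ → ℕ} (hf : c.Comp f) (hg : c.Comp g) : c.Dec fun γ => f γ < g γ :=
  (hg.le hf).not.congr fun _ _ => by omega

theorem Comp.eq {f g : Γ → ℕ} (hf : c.Comp f) (hg : c.Comp g) : c.Dec fun γ => f γ = g γ :=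
  ((hf.le hg).and (hg.le hf)).congr fun _ _ => by omega

theorem Comp.sum {b : Γ → ℕ} {g : Γ → ℕ → ℕ} (hb : c.Comp b) (pb : c.Poly b)
    (hg : (c.idx b).Comp fun p => g p.1 p.2) : c.Comp fun γ => ∑ i ∈ range (b γ), g γ i :=
  (Comp.iter (g := fun γ i a => a + g γ i) hb pb (.const 0) (Comp.top.add hg.weak)).congr
    fun γ _ => by
      induction b γ with
      | zero => rfl
      | succ n ih => rw [sum_range_succ, ← ih]

open Classical in
theorem Dec.count {b : Γ → ℕ} {p : Γ → ℕ → Prop} (hb : c.Comp b) (pb : c.Poly b)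
    (hp : (c.idx b).Dec fun x => p x.1 x.2) :
    c.Comp fun γ => ((range (b γ)).filter (p γ)).card :=
  (Comp.sum (g := fun γ i => if p γ i then 1 else 0) hb pb hp).congr fun γ _ => by
    rw [card_filter]

theorem Dec.ex {b : Γ → ℕ} {p : Γ → ℕ → Prop} (hb : c.Comp b) (pb : c.Poly b)
    (hp : (c.idx b).Dec fun x => p x.1 x.2) : c.Dec fun γ => ∃ i < b γ, p γ i := by
  classical
  exact (Dec.count hb pb hp).eqZero.not.congr fun γ _ => by
    simp [filter_eq_empty_iff]

theorem Dec.all {b : Γ → ℕ} {p : Γ → ℕ → Prop} (hb : c.Comp b) (pb : c.Poly b)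
    (hp : (c.idx b).Dec fun x => p x.1 x.2) : c.Dec fun γ => ∀ i < b γ, p γ i :=
  (Dec.ex (p := fun γ i => ¬ p γ i) hb pb hp.not).not.congr fun γ _ => by
    push Not
    rfl

/-- Repeated addition: only the first factor, the number of rounds, has to be polynomially bounded.
-/
theorem Comp.mul {f g : Γ → ℕ} (hf : c.Comp f) (pf : c.Poly f) (hg : c.Comp g) :
    c.Comp fun γ => f γ * g γ :=
  (Comp.sum (g := fun γ _ => g γ) hf pf hg.weak).congr fun γ _ => by simp

theorem Comp.pow {f g : Γ → ℕ} (hf : c.Comp f) (pf : c.Poly f) (hg : c.Comp g) (pg : c.Poly g) :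
    c.Comp fun γ => f γ ^ g γ :=
  (Comp.iter (g := fun γ _ a => f γ * a) hg pg (.const 1)
    (Comp.mul hf.weak.weak pf.weak.weak Comp.top)).congr fun γ _ => by
      induction g γ with
      | zero => rfl
      | succ n ih => rw [pow_succ', ← ih]

theorem Comp.div {f g : Γ → ℕ} (hf : c.Comp f) (pf : c.Poly f) (hg : c.Comp g) :
    c.Comp fun γ => f γ / g γ := by
  classical
  refine (Dec.count (p := fun γ q => 0 < g γ ∧ (q + 1) * g γ ≤ f γ) hf pf
    (((Comp.const 0).lt hg.weak).and (((Comp.top.add (.const 1)).mul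
      (pf.idx.add (.const 1)) hg.weak).le hf.weak))).congr fun γ _ => ?_
  rcases Nat.eq_zero_or_pos (g γ) with h | h
  · simp [h]
  · refine Eq.trans (congrArg card ?_) (card_range (f γ / g γ))
    ext q
    have := Nat.div_le_self (f γ) (g γ)
    simp only [mem_filter, mem_range, h, true_and, ← Nat.le_div_iff_mul_le h]
    omega

theorem Comp.mod {f g : Γ → ℕ} (hf : c.Comp f) (pf : c.Poly f) (hg : c.Comp g) :
    c.Comp fun γ => f γ % g γ :=
  (hf.sub ((hf.div pf hg).mul (pf.mono fun _ _ => Nat.div_le_self _ _) hg)).congr fun γ _ => by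
    have := Nat.div_add_mod (f γ) (g γ)
    rw [Nat.mul_comm] at this
    omega

/-- The binary digits of a number. -/
theorem Comp.bit {f g : Γ → ℕ} (hf : c.Comp f) (pf : c.Poly f) (hg : c.Comp g) (pg : c.Poly g) :
    c.Dec fun γ => (f γ).testBit (g γ) = true :=
  (((hf.div pf ((Comp.const 2).pow (.const 2) hg pg)).mod
    (pf.mono fun _ _ => Nat.div_le_self _ _) (.const 2)).eq (.const 1)).congr fun γ _ => by
      rw [Nat.testBit_eq_decide_div_mod_eq, decide_eq_true_iff]

end Ctx

/-! ### Families of sets with large union -/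

section Families

variable {U : Type*} [DecidableEq U]

/-- The union of some members of `𝒮` exceeds `t` times their number by at least `D`. -/
def HasSurplus (t D : ℕ) (𝒮 : Finset (Finset U)) : Prop :=
  ∃ F ⊆ 𝒮, D + t * F.card ≤ (F.biUnion id).card

/-- Take a largest `G` with at most `D` members that gains at least `t + 1` elements per member. If
`G` has no surplus, then it has fewer than `D` members, so a set with more than `t` new elements
could still be added, against maximality. -/
theorem exists_greedy (𝒮 : Finset (Finset U)) (t D : ℕ) :
    ∃ G ⊆ 𝒮, G.card ≤ D ∧ (D + t * G.card ≤ (G.biUnion id).card ∨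
      ((G.biUnion id).card < D + t * G.card ∧ ∀ A ∈ 𝒮, (A \ G.biUnion id).card ≤ t)) := by
  obtain ⟨G, hG, hmax⟩ := exists_max_image
    (𝒮.powerset.filter fun G => G.card ≤ D ∧ (t + 1) * G.card ≤ (G.biUnion id).card) card
    ⟨∅, by simp⟩
  simp only [mem_filter, mem_powerset, and_imp] at hG hmax
  obtain ⟨hGS, hGD, hG⟩ := hG
  refine ⟨G, hGS, hGD, ?_⟩
  by_contra! h
  obtain ⟨A, hA, hAt⟩ := h.2 h.1
  have hAG : A ∉ G := by
    intro hAG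
    have : A \ G.biUnion id = ∅ := sdiff_eq_empty_iff_subset.2 (subset_biUnion_of_mem id hAG)
    simp [this] at hAt
  have hc : ((insert A G).biUnion id).card = (A \ G.biUnion id).card + (G.biUnion id).card := by
    rw [biUnion_insert, id, ← card_sdiff_add_card]
  have := hmax (insert A G) (insert_subset hA hGS)
    (by rw [card_insert_of_notMem hAG]; nlinarith [h.1])
    (by rw [card_insert_of_notMem hAG, hc]; linarith)
  rw [card_insert_of_notMem hAG] at this
  omega

theorem HasSurplus.exists_card_le {t D : ℕ} {𝒮 : Finset (Finset U)} (h : HasSurplus t D 𝒮) :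
    ∃ F ⊆ 𝒮, F.card ≤ D ∧ D + t * F.card ≤ (F.biUnion id).card := by
  obtain ⟨F, hF, hD⟩ := h
  -- The greedy argument runs inside `F`. In its second outcome the members outside `G` contribute
  -- at most `t` elements each, so `F` itself would have no surplus.
  obtain ⟨G, hG, hGD, hG' | ⟨h1, h2⟩⟩ := exists_greedy F t D
  · exact ⟨G, hG.trans hF, hGD, hG'⟩
  · have hsub : F.biUnion id ⊆ G.biUnion id ∪ (F \ G).biUnion fun A => A \ G.biUnion id := by
      intro u hu
      obtain ⟨A, hA, huA⟩ := mem_biUnion.1 hu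
      by_cases huG : u ∈ G.biUnion id
      · exact mem_union_left _ huG
      · refine mem_union_right _ (mem_biUnion.2 ⟨A, mem_sdiff.2 ⟨hA, fun hAG => huG ?_⟩,
          mem_sdiff.2 ⟨huA, huG⟩⟩)
        exact mem_biUnion.2 ⟨A, hAG, huA⟩
    have h3 := (card_le_card hsub).trans (card_union_le _ _)
    have h4 : ((F \ G).biUnion fun A => A \ G.biUnion id).card ≤ (F \ G).card * t :=
      card_biUnion_le_card_mul _ _ _ fun A hA => h2 A (mem_sdiff.1 hA).1
    have h5 := card_sdiff_add_card_eq_card hG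
    rw [← h5] at hD
    nlinarith

/-- Each such set is the range of a `t`-tuple in `Option U`, with `none` as padding. -/
theorem card_filter_card_le [Fintype U] (t : ℕ) :
    ((univ : Finset (Finset U)).filter fun A => A.card ≤ t).card ≤ (Fintype.card U + 1) ^ t := by
  have h : ((univ : Finset (Finset U)).filter fun A => A.card ≤ t) ⊆
      (univ : Finset (Fin t → Option U)).image fun τ => eraseNone (univ.image τ) := by
    intro A hA
    have hA : A.card ≤ t := by simpa using hA
    refine mem_image.2 ⟨fun i => if h : (i : ℕ) < A.card then
      some (A.equivFin.symm ⟨i, h⟩ : U) else none, mem_univ _, ?_⟩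
    ext u
    simp only [mem_eraseNone, mem_image, mem_univ, true_and]
    constructor
    · rintro ⟨i, hi⟩
      split_ifs at hi with h
      · cases hi
        exact (A.equivFin.symm ⟨i, h⟩).2
    · intro hu
      have hlt := (A.equivFin ⟨u, hu⟩).2
      exact ⟨⟨A.equivFin ⟨u, hu⟩, hlt.trans_le hA⟩, by simp⟩
  refine (card_le_card h).trans (card_image_le.trans ?_)
  simp

/-- A family without surplus is small. -/
theorem card_le_of_not_hasSurplus [Fintype U] {t D : ℕ} {𝒮 : Finset (Finset U)}
    (h : ¬ HasSurplus t D 𝒮) :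
    𝒮.card ≤ 2 ^ (D + t * D) * (Fintype.card U + 1) ^ t := by
  obtain ⟨G, hG, hGD, hG' | ⟨h1, h2⟩⟩ := exists_greedy 𝒮 t D
  · exact absurd ⟨G, hG, hG'⟩ h
  · have hinj : Set.InjOn (fun A : Finset U => (A ∩ G.biUnion id, A \ G.biUnion id)) 𝒮 := by
      intro A _ B _ hAB
      simp only [Prod.mk.injEq] at hAB
      rw [← sdiff_union_inter A (G.biUnion id), hAB.1, hAB.2, sdiff_union_inter]
    have hmap : 𝒮.card ≤ ((G.biUnion id).powerset ×ˢ
        ((univ : Finset (Finset U)).filter fun A => A.card ≤ t)).card :=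
      card_le_card_of_injOn _ (fun A hA => mem_coe.2 (mem_product.2
        ⟨mem_powerset.2 inter_subset_right, mem_filter.2 ⟨mem_univ _, h2 A hA⟩⟩)) hinj
    rw [card_product, card_powerset] at hmap
    refine hmap.trans (Nat.mul_le_mul (Nat.pow_le_pow_right (by omega) ?_)
      (card_filter_card_le t))
    have := Nat.mul_le_mul_left t hGD
    omega

theorem exists_cover_of_card_le [Fintype U] {t : ℕ} (ht : t ≤ Fintype.card U) (q : ℕ)
    (R : Finset U) (hR : R.card ≤ t * q) :
    ∃ 𝒯 : Finset (Finset U), (∀ A ∈ 𝒯, A.card = t) ∧ 𝒯.card ≤ q ∧ R ⊆ 𝒯.biUnion id := by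
  induction q generalizing R with
  | zero => exact ⟨∅, by simp, by simp, by simp_all⟩
  | succ q ih =>
    obtain ⟨R₁, hR₁, hc⟩ := exists_subset_card_eq (min_le_right t R.card)
    obtain ⟨A, hA, hAt⟩ := exists_superset_card_eq (s := R₁) (n := t) (by omega) ht
    obtain ⟨𝒯, h1, h2, h3⟩ := ih (R \ R₁) (by
      rw [card_sdiff_of_subset hR₁, Nat.mul_succ] at *
      omega)
    refine ⟨insert A 𝒯, ?_, (card_insert_le _ _).trans (by omega), ?_⟩
    · intro B hB
      rcases mem_insert.1 hB with rfl | hB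
      · exact hAt
      · exact h1 B hB
    · rw [biUnion_insert]
      intro u hu
      by_cases hu1 : u ∈ R₁
      · exact mem_union_left _ (hA hu1)
      · exact mem_union_right _ (h3 (mem_sdiff.2 ⟨hu, hu1⟩))

/-- A cover is its own witness when `D` is positive, since then the universe has exactly `D + t * (r
- k)` elements. Conversely, a surplus leaves at most `t * (r - k - F.card)` elements, which `t`-sets
cover; these exist because `t` does not exceed the size of the universe. -/
theorem hasCover_iff_hasSurplus [Fintype U] {t : ℕ} (ht : 1 ≤ t) (htn : t ≤ Fintype.card U)
    {𝒮 : Finset (Finset U)} (h𝒮 : SetCover.IsUniform t 𝒮) {r k : ℕ} :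
    SetCover.HasCover 𝒮 ((r : ℤ) - k) ↔ HasSurplus t (Fintype.card U - t * (r - k)) 𝒮 := by
  constructor
  · rintro ⟨𝒞, h1, h2, h3⟩
    rcases Nat.eq_zero_or_pos (Fintype.card U - t * (r - k)) with h0 | h0
    · exact ⟨∅, by simp, by simp [h0]⟩
    · refine ⟨𝒞, h1, ?_⟩
      have hu : 𝒞.biUnion id = univ := by
        ext u
        simpa using h2 u
      rw [hu, card_univ]
      have := Nat.mul_le_mul_left t (show 𝒞.card ≤ r - k by omega)
      omega
  · rintro ⟨F, hF, hD⟩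
    have hle := card_le_univ (F.biUnion id)
    rcases Nat.eq_zero_or_pos (Fintype.card U - t * (r - k)) with h0 | h0
    · obtain ⟨𝒯, h1, h2, h3⟩ := exists_cover_of_card_le htn (r - k) univ
        (by rw [card_univ]; omega)
      have hrk : 1 ≤ r - k := by
        by_contra hrk
        rw [show r - k = 0 by omega] at h0
        omega
      refine ⟨𝒯, fun A hA => h𝒮 A (h1 A hA), fun u => ?_, by omega⟩
      simpa using h3 (mem_univ u)
    · have hFr : F.card ≤ r - k := by
        by_contra hc
        have := Nat.mul_le_mul_left t (show r - k ≤ F.card by omega)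
        have := Nat.mul_lt_mul_of_pos_left (show r - k < F.card by omega) (show 0 < t by omega)
        omega
      -- A truncated difference 0 could stand for a negative integer. It would force `F` to be
      -- empty, with a union as large as the nonempty universe.
      have hrk : 1 ≤ r - k := by
        by_contra hrk
        obtain hrk : r - k = 0 := by omega
        rw [hrk, Nat.mul_zero] at hD
        have : F = ∅ := card_eq_zero.1 (by omega)
        subst this
        simp at hD
        omega
      obtain ⟨𝒯, h1, h2, h3⟩ := exists_cover_of_card_le htn (r - k - F.card)
        (F.biUnion id)ᶜ (by
          rw [card_compl, Nat.mul_sub]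
          omega)
      refine ⟨F ∪ 𝒯, union_subset hF fun A hA => h𝒮 A (h1 A hA), fun u => ?_, ?_⟩
      · by_cases hu : u ∈ F.biUnion id
        · obtain ⟨A, hA, huA⟩ := mem_biUnion.1 hu
          exact ⟨A, mem_union_left _ hA, huA⟩
        · obtain ⟨A, hA, huA⟩ := mem_biUnion.1 (h3 (mem_compl.2 hu))
          exact ⟨A, mem_union_right _ hA, huA⟩
      · have := card_union_le F 𝒯
        omega

end Families

/-! ### Subsets of `range c` as numbers, and inclusion-exclusion -/

/-- The positions below `c` of the binary digits 1 of `Z`. -/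
def bits (c Z : ℕ) : Finset ℕ := (range c).filter fun i => Z.testBit i = true

theorem bits_injOn (c : ℕ) : Set.InjOn (bits c) (range (2 ^ c)) := by
  intro Z hZ Z' hZ' h
  have hZ : Z < 2 ^ c := by simpa using hZ
  have hZ' : Z' < 2 ^ c := by simpa using hZ'
  refine Nat.eq_of_testBit_eq fun i => ?_
  by_cases hi : i < c
  · have := congrArg (i ∈ ·) h
    simp only [bits, mem_filter, mem_range, hi, true_and, eq_iff_iff] at this
    exact Bool.eq_iff_iff.2 this
  · have hci := Nat.pow_le_pow_right (show 0 < 2 by omega) (not_lt.1 hi)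
    rw [Nat.testBit_lt_two_pow (hZ.trans_le hci), Nat.testBit_lt_two_pow (hZ'.trans_le hci)]

theorem image_bits (c : ℕ) : (range (2 ^ c)).image (bits c) = (range c).powerset := by
  refine eq_of_subset_of_card_le (fun s hs => ?_) ?_
  · obtain ⟨Z, _, rfl⟩ := mem_image.1 hs
    exact mem_powerset.2 (filter_subset _ _)
  · rw [card_image_of_injOn (bits_injOn c), card_powerset, card_range, card_range]

theorem exists_bits_eq {c : ℕ} {s : Finset ℕ} (hs : s ⊆ range c) : ∃ Z < 2 ^ c, bits c Z = s := by
  have := mem_powerset.2 hs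
  rw [← image_bits] at this
  simpa using this

theorem mem_bits {c Z i : ℕ} (hZ : Z < 2 ^ c) : i ∈ bits c Z ↔ Z.testBit i = true := by
  simp only [bits, mem_filter, mem_range, and_iff_right_iff_imp]
  intro h
  by_contra hi
  rw [Nat.testBit_lt_two_pow (hZ.trans_le (Nat.pow_le_pow_right (by omega) (not_lt.1 hi)))] at h
  cases h

/-- Inclusion-exclusion for the number of `j`-tuples of sets that cover `C`. -/
theorem sum_neg_one_pow_mul_card_pow (g : ℕ → Finset ℕ) (m j : ℕ) (C : Finset ℕ) :
    ∑ Z ∈ C.powerset, (-1 : ℤ) ^ Z.card * (((range m).filter fun s => Disjoint (g s) Z).card : ℤ) ^ j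
      = (((Fintype.piFinset fun _ : Fin j => range m).filter
          fun τ => C ⊆ univ.biUnion fun i => g (τ i)).card : ℤ) := by
  have h1 : ∀ Z : Finset ℕ, (((range m).filter fun s => Disjoint (g s) Z).card : ℤ) ^ j =
      ∑ τ ∈ Fintype.piFinset fun _ : Fin j => range m,
        if Disjoint (univ.biUnion fun i => g (τ i)) Z then (1 : ℤ) else 0 := by
    intro Z
    rw [← sum_filter, sum_const, nsmul_eq_mul, mul_one]
    have : ((Fintype.piFinset fun _ : Fin j => range m).filter
        fun τ => Disjoint (univ.biUnion fun i => g (τ i)) Z) =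
        Fintype.piFinset fun _ : Fin j => (range m).filter fun s => Disjoint (g s) Z := by
      ext τ
      simp only [mem_filter, Fintype.mem_piFinset, disjoint_biUnion_left, mem_univ, true_implies]
      exact forall_and.symm
    rw [this, Fintype.card_piFinset_const]
    push_cast
    rfl
  simp_rw [h1, mul_sum]
  rw [sum_comm, card_filter]
  push_cast
  refine sum_congr rfl fun τ _ => ?_
  -- For a fixed tuple, the surviving `Z` are the subsets of the uncovered part of `C`; their
  -- alternating sum is 1 if that part is empty and 0 otherwise.
  have h2 : C.powerset.filter (fun Z => Disjoint (univ.biUnion fun i => g (τ i)) Z) =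
      (C \ univ.biUnion fun i => g (τ i)).powerset := by
    ext Z
    simp only [mem_filter, mem_powerset, subset_sdiff, disjoint_comm]
  simp only [mul_ite, mul_one, mul_zero]
  rw [← sum_filter, h2, sum_powerset_neg_one_pow_card]
  simp only [sdiff_eq_empty_iff_subset]

/-- The number of sets among the first `m` that avoid the set coded by `Z`. -/
def avoiding (g : ℕ → Finset ℕ) (m Z : ℕ) : ℕ :=
  ((range m).filter fun s => ∀ x ∈ g s, ¬ Z.testBit x = true).card

/-- The contribution to the inclusion-exclusion formula of the subsets of the set coded by `C`
whose size has the parity `e`. -/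
def parityTerm (g : ℕ → Finset ℕ) (m j c e C : ℕ) : ℕ :=
  ∑ Z ∈ range (2 ^ c), if (∀ i < c, Z.testBit i = true → C.testBit i = true) ∧
    (bits c Z).card % 2 = e then avoiding g m Z ^ j else 0

/-- The machine has no negative numbers, so the alternating sum is split by parity. Even part minus
odd part is the number of covering tuples. -/
theorem parityTerm_lt_iff (g : ℕ → Finset ℕ) (m j c C : ℕ) :
    parityTerm g m j c 1 C < parityTerm g m j c 0 C ↔
      ∃ τ : Fin j → ℕ, (∀ i, τ i < m) ∧ bits c C ⊆ univ.biUnion fun i => g (τ i) := by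
  have key : (parityTerm g m j c 0 C : ℤ) - parityTerm g m j c 1 C =
      ∑ Z ∈ (bits c C).powerset,
        (-1 : ℤ) ^ Z.card * (((range m).filter fun s => Disjoint (g s) Z).card : ℤ) ^ j := by
    have h1 : (bits c C).powerset = (range c).powerset.filter (· ⊆ bits c C) := by
      ext Z
      simp only [mem_powerset, mem_filter]
      exact ⟨fun h => ⟨h.trans (filter_subset _ _), h⟩, fun h => h.2⟩
    rw [h1, sum_filter, ← image_bits, sum_image (bits_injOn c), parityTerm, parityTerm]
    push_cast
    rw [← sum_sub_distrib]
    refine sum_congr rfl fun Z hZ => ?_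
    have hZ := mem_range.1 hZ
    have h2 : (∀ i < c, Z.testBit i = true → C.testBit i = true) ↔ bits c Z ⊆ bits c C := by
      simp only [bits, subset_iff, mem_filter, mem_range]
      exact ⟨fun h i hi => ⟨hi.1, h i hi.1 hi.2⟩, fun h i hi hZ => (h ⟨hi, hZ⟩).2⟩
    have h3 : avoiding g m Z = ((range m).filter fun s => Disjoint (g s) (bits c Z)).card := by
      simp only [avoiding, disjoint_left, mem_bits hZ]
    simp only [h2, h3]
    by_cases hs : bits c Z ⊆ bits c C
    · rcases Nat.mod_two_eq_zero_or_one (bits c Z).card with h | h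
      · simp [hs, h, (Nat.even_iff.2 h).neg_one_pow]
      · simp [hs, h, (Nat.odd_iff.2 h).neg_one_pow]
    · simp [hs]
  rw [sum_neg_one_pow_mul_card_pow] at key
  have : parityTerm g m j c 1 C < parityTerm g m j c 0 C ↔
      0 < ((Fintype.piFinset fun _ : Fin j => range m).filter
          fun τ => bits c C ⊆ univ.biUnion fun i => g (τ i)).card := by omega
  rw [this, card_pos]
  simp only [Finset.Nonempty, mem_filter, Fintype.mem_piFinset, mem_range]

/-! ### A small family of colorings, one of them injective on any given small set -/

/-- The hash functions. -/
def hash (m p a x : ℕ) : ℕ := a * x % p % m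

/-- The difference of the residues determines `a`, because `x - y` is invertible modulo `p`, and it
is a positive multiple of `m` below `p`. -/
theorem card_filter_dvd_mod_sub_mod_le {p : ℕ} (hp : p.Prime) {x y : ℕ} (hx : x < p) (hy : y < p)
    (hxy : x ≠ y) (m : ℕ) :
    ((Ioc 0 (p - 1)).filter fun a => a * y % p < a * x % p ∧ m ∣ a * x % p - a * y % p).card ≤
      (p - 1) / m := by
  have := Fact.mk hp
  rw [← Nat.Ioc_filter_dvd_card_eq_div]
  refine card_le_card_of_injOn (fun a => a * x % p - a * y % p) (fun a ha => ?_) ?_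
  · simp only [coe_filter, mem_Ioc, Set.mem_ofPred_eq] at ha ⊢
    have := Nat.mod_lt (a * x) hp.pos
    exact ⟨⟨by omega, by omega⟩, ha.2.2⟩
  · intro a ha b hb hab
    simp only [coe_filter, mem_Ioc, Set.mem_ofPred_eq] at ha hb hab
    have h := congrArg (Nat.cast : ℕ → ZMod p) hab
    rw [Nat.cast_sub ha.2.1.le, Nat.cast_sub hb.2.1.le] at h
    simp only [ZMod.natCast_mod, Nat.cast_mul, ← mul_sub] at h
    have hne : (x : ZMod p) - y ≠ 0 := by
      rw [sub_ne_zero, Ne, ZMod.natCast_eq_natCast_iff', Nat.mod_eq_of_lt hx, Nat.mod_eq_of_lt hy]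
      exact hxy
    have h := mul_right_cancel₀ hne h
    rwa [ZMod.natCast_eq_natCast_iff', Nat.mod_eq_of_lt (by omega), Nat.mod_eq_of_lt (by omega)]
      at h

theorem card_filter_hash_eq_le {p : ℕ} (hp : p.Prime) {x y : ℕ} (hx : x < p) (hy : y < p)
    (hxy : x ≠ y) (m : ℕ) :
    ((Ioc 0 (p - 1)).filter fun a => hash m p a x = hash m p a y).card ≤ 2 * ((p - 1) / m) := by
  have := Fact.mk hp
  have hsub : ((Ioc 0 (p - 1)).filter fun a => hash m p a x = hash m p a y) ⊆
      ((Ioc 0 (p - 1)).filter fun a => a * y % p < a * x % p ∧ m ∣ a * x % p - a * y % p) ∪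
      ((Ioc 0 (p - 1)).filter fun a => a * x % p < a * y % p ∧ m ∣ a * y % p - a * x % p) := by
    intro a ha
    rw [mem_filter] at ha
    obtain ⟨ha, h⟩ := ha
    rw [mem_union, mem_filter, mem_filter]
    rw [mem_Ioc] at ha
    rcases lt_trichotomy (a * y % p) (a * x % p) with h1 | h1 | h1
    · exact Or.inl ⟨mem_Ioc.2 ha, h1, (Nat.modEq_iff_dvd' h1.le).1 (Eq.symm h)⟩
    · exfalso
      have h2 : ((a * y : ℕ) : ZMod p) = ((a * x : ℕ) : ZMod p) :=
        (ZMod.natCast_eq_natCast_iff' _ _ _).2 h1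
      push_cast at h2
      have hne : (a : ZMod p) ≠ 0 := by
        rw [Ne, ZMod.natCast_eq_zero_iff]
        exact Nat.not_dvd_of_pos_of_lt ha.1 (by have := hp.pos; omega)
      have h3 := mul_left_cancel₀ hne h2
      rw [ZMod.natCast_eq_natCast_iff', Nat.mod_eq_of_lt hx, Nat.mod_eq_of_lt hy] at h3
      exact hxy h3.symm
    · exact Or.inr ⟨mem_Ioc.2 ha, h1, (Nat.modEq_iff_dvd' h1.le).1 h⟩
  have h1 := card_filter_dvd_mod_sub_mod_le hp hx hy hxy m
  have h2 := card_filter_dvd_mod_sub_mod_le hp hy hx hxy.symm m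
  have := (card_le_card hsub).trans (card_union_le _ _)
  omega

/-- Some hash function has few collisions. -/
theorem exists_hash {p : ℕ} (hp : p.Prime) (m : ℕ) (S : Finset ℕ) (hS : ∀ x ∈ S, x < p) :
    ∃ a < p, (S.offDiag.filter fun q => hash m p a q.1 = hash m p a q.2).card * m ≤
      2 * S.card ^ 2 := by
  by_contra! h
  -- Averaging over the `p - 1` nonzero multipliers: each pair collides for at most `2 * ((p - 1) /
  -- m)` of them.
  have h1 : ∑ a ∈ Ioc 0 (p - 1),
      (S.offDiag.filter fun q => hash m p a q.1 = hash m p a q.2).card * m ≤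
      2 * S.card ^ 2 * (p - 1) := by
    rw [← sum_mul]
    simp_rw [card_filter]
    rw [sum_comm]
    simp_rw [← card_filter]
    calc _ ≤ (∑ q ∈ S.offDiag, 2 * ((p - 1) / m)) * m := by
          refine Nat.mul_le_mul_right _ (sum_le_sum fun q hq => ?_)
          obtain ⟨h1, h2, h3⟩ := mem_offDiag.1 hq
          exact card_filter_hash_eq_le hp (hS _ h1) (hS _ h2) h3 m
      _ = 2 * S.offDiag.card * ((p - 1) / m * m) := by
          rw [sum_const, smul_eq_mul]
          ring
      _ ≤ _ := Nat.mul_le_mul (Nat.mul_le_mul_left _ ?_) (Nat.div_mul_le_self _ _)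
    rw [offDiag_card, sq]
    omega
  have h2 : ∑ a ∈ Ioc 0 (p - 1), (2 * S.card ^ 2 + 1) ≤ ∑ a ∈ Ioc 0 (p - 1),
      (S.offDiag.filter fun q => hash m p a q.1 = hash m p a q.2).card * m :=
    sum_le_sum fun a ha => h a (by rw [mem_Ioc] at ha; have := hp.pos; omega)
  rw [sum_const, Nat.card_Ioc, smul_eq_mul] at h2
  have := hp.two_le
  have h3 := h2.trans h1
  rw [Nat.sub_zero, Nat.mul_comm] at h3
  have := Nat.le_of_mul_le_mul_right h3 (by omega)
  omega

/-- The color offered on level `i` with multiplier `a`. -/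
def levelColor (p : ℕ) (a : ℕ → ℕ) (y i : ℕ) : ℕ := 2 ^ (i + 2) + hash (2 ^ (i + 2)) p (a i) y

/-- The color of `y` is the one offered by the last of `l` levels that offers a color in `T`. -/
def levelColoring (p : ℕ) (a : ℕ → ℕ) (T : ℕ → Prop) [DecidablePred T] (y : ℕ) : ℕ → ℕ
  | 0 => 0
  | i + 1 => if T (levelColor p a y i) then levelColor p a y i else levelColoring p a T y i

theorem levelColor_lt (p : ℕ) (a : ℕ → ℕ) (y i : ℕ) : levelColor p a y i < 2 ^ (i + 3) := by
  have := Nat.mod_lt (a i * y % p) (show 0 < 2 ^ (i + 2) by positivity)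
  rw [levelColor, hash, pow_succ _ (i + 2)]
  omega

theorem levelColoring_lt (p : ℕ) (a : ℕ → ℕ) (T : ℕ → Prop) [DecidablePred T] (y l : ℕ) :
    levelColoring p a T y l < 2 ^ (l + 2) := by
  induction l with
  | zero => simp [levelColoring]
  | succ l ih =>
    rw [levelColoring]
    split_ifs
    · exact levelColor_lt p a y l
    · exact ih.trans (Nat.pow_lt_pow_right (by omega) (by omega))

theorem levelColoring_congr {p : ℕ} {a a' : ℕ → ℕ} {T T' : ℕ → Prop} [DecidablePred T]
    [DecidablePred T'] (l : ℕ) (ha : ∀ i < l, a i = a' i) (hT : ∀ v < 2 ^ (l + 2), T v ↔ T' v)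
    (y : ℕ) : levelColoring p a T y l = levelColoring p a' T' y l := by
  induction l with
  | zero => rfl
  | succ l ih =>
    have h1 : levelColor p a y l = levelColor p a' y l := by
      rw [levelColor, levelColor, ha l (by omega)]
    rw [levelColoring, levelColoring, h1, ih (fun i hi => ha i (by omega))
      fun v hv => hT v (hv.trans (Nat.pow_lt_pow_right (by omega) (by omega)))]
    simp only [hT _ (levelColor_lt p a' y l)]

/-- Induction from the top level down. A good hash function into `2 ^ (l + 2)` values leaves at most
a quarter of `2 ^ (l + 1)` elements in collisions; these are passed to the lower levels. The others
get private colors in the block from `2 ^ (l + 2)` to `2 ^ (l + 3)`, recorded in `T`. The number of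
colors thus stays linear in the bound on the size of `S`. -/
theorem exists_levelColoring {p : ℕ} (hp : p.Prime) (l : ℕ) (S : Finset ℕ) (hS : ∀ x ∈ S, x < p)
    (hc : 2 * S.card ≤ 2 ^ l) : ∃ (a : ℕ → ℕ) (T : Finset ℕ), (∀ i, a i < p) ∧
      T ⊆ range (2 ^ (l + 2)) ∧ Set.InjOn (fun y => levelColoring p a (· ∈ T) y l) S := by
  induction l generalizing S with
  | zero =>
    have : S = ∅ := card_eq_zero.1 (by omega)
    subst this
    exact ⟨fun _ => 0, ∅, fun _ => hp.pos, by simp, by simp⟩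
  | succ l ih =>
    obtain ⟨b, hb, hcoll⟩ := exists_hash hp (2 ^ (l + 2)) S hS
    let h := hash (2 ^ (l + 2)) p b
    let S₁ := S.filter fun x => ∃ y ∈ S, x ≠ y ∧ h x = h y
    have hS₁ : S₁.card ≤ (S.offDiag.filter fun q => h q.1 = h q.2).card := by
      refine (card_le_card (t := image Prod.fst _) fun x hx => ?_).trans card_image_le
      obtain ⟨hx, y, hy, hxy, he⟩ := mem_filter.1 hx
      exact mem_image.2 ⟨(x, y), mem_filter.2 ⟨mem_offDiag.2 ⟨hx, hy, hxy⟩, he⟩, rfl⟩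
    have hS₁' : 2 * S₁.card ≤ 2 ^ l := by
      have h1 : S.card ≤ 2 ^ l := by rw [pow_succ] at hc; omega
      have h2 : S₁.card * 2 ^ (l + 2) ≤ 2 * (2 ^ l) ^ 2 :=
        (Nat.mul_le_mul_right _ hS₁).trans (hcoll.trans (by gcongr))
      have h3 : 0 < 2 ^ l := by positivity
      rw [pow_add] at h2
      nlinarith
    obtain ⟨a, T, ha, hT, hinj⟩ := ih S₁ (fun x hx => hS x (mem_filter.1 hx).1) hS₁'
    let a' : ℕ → ℕ := fun i => if i = l then b else a i
    let T' := T ∪ (S \ S₁).image fun y => 2 ^ (l + 2) + h y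
    have hlc : ∀ y, levelColor p a' y l = 2 ^ (l + 2) + h y := fun y => by
      simp [levelColor, a', h]
    have hlow : ∀ y, levelColoring p a' (· ∈ T') y l = levelColoring p a (· ∈ T) y l :=
      fun y => levelColoring_congr l (fun i hi => by simp [a', hi.ne]) (fun v hv => by
        simp only [T', mem_union, mem_image, or_iff_left_iff_imp, forall_exists_index, and_imp]
        intro z _ hz
        omega) y
    have hin : ∀ y ∈ S \ S₁, levelColoring p a' (· ∈ T') y (l + 1) = 2 ^ (l + 2) + h y := by
      intro y hy
      rw [levelColoring, hlc, if_pos (mem_union_right _ (mem_image_of_mem _ hy))]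
    have hout : ∀ y ∈ S₁, levelColoring p a' (· ∈ T') y (l + 1) =
        levelColoring p a (· ∈ T) y l := by
      intro y hy
      -- A colliding element is not offered a recorded color on the top level: only elements without
      -- collisions record theirs.
      rw [levelColoring, hlc, if_neg, hlow]
      intro hmem
      rcases mem_union.1 hmem with h1 | h1
      · have := mem_range.1 (hT h1)
        omega
      · obtain ⟨z, hz, hzy⟩ := mem_image.1 h1
        have hzy : h z = h y := by simpa using hzy
        rw [mem_sdiff] at hz
        refine hz.2 (mem_filter.2 ⟨hz.1, y, (mem_filter.1 hy).1, ?_, hzy⟩)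
        rintro rfl
        exact hz.2 hy
    refine ⟨a', T', fun i => ?_, union_subset (hT.trans (range_subset_range.2
      (Nat.pow_le_pow_right (by omega) (by omega)))) fun v hv => ?_, fun y hy z hz hyz => ?_⟩
    · by_cases hi : i = l <;> simp [a', hi, hb, ha]
    · obtain ⟨y, _, rfl⟩ := mem_image.1 hv
      rw [← hlc y]
      exact mem_range.2 (levelColor_lt p a' y l)
    · dsimp only at hyz
      by_cases hy1 : y ∈ S₁ <;> by_cases hz1 : z ∈ S₁
      · rw [hout y hy1, hout z hz1] at hyz
        exact hinj hy1 hz1 hyz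
      · rw [hout y hy1, hin z (mem_sdiff.2 ⟨hz, hz1⟩)] at hyz
        have := levelColoring_lt p a (· ∈ T) y l
        omega
      · rw [hout z hz1, hin y (mem_sdiff.2 ⟨hy, hy1⟩)] at hyz
        have := levelColoring_lt p a (· ∈ T) z l
        omega
      · rw [hin y (mem_sdiff.2 ⟨hy, hy1⟩), hin z (mem_sdiff.2 ⟨hz, hz1⟩)] at hyz
        by_contra hne
        exact hy1 (mem_filter.2 ⟨hy, z, hz, hne, by omega⟩)

/-- Packs the multipliers of all levels into one number, so that a single bounded search finds them.
-/
theorem exists_digits {p : ℕ} (l : ℕ) (a : ℕ → ℕ) (ha : ∀ i, a i < p) :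
    ∃ s < p ^ l, ∀ i < l, s / p ^ i % p = a i := by
  have hp : 0 < p := (Nat.zero_le _).trans_lt (ha 0)
  induction l generalizing a with
  | zero => exact ⟨0, by simp, by simp⟩
  | succ l ih =>
    obtain ⟨s, hs, h⟩ := ih (fun i => a (i + 1)) fun i => ha _
    refine ⟨a 0 + p * s, ?_, fun i hi => ?_⟩
    · have := ha 0
      rw [pow_succ']
      nlinarith
    · cases i with
      | zero => simp [Nat.mod_eq_of_lt (ha 0)]
      | succ i =>
        rw [pow_succ', ← Nat.div_div_eq_div_mul, Nat.add_mul_div_left _ _ hp,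
          Nat.div_eq_of_lt (ha 0), zero_add, h i (by omega)]

/-- The coloring given by the seeds `p₀`, `a₀`, `p`, `s`, `T` and the number `l` of levels, the
intermediate range being `range M`. -/
def coloring (M p₀ a₀ p s T l x : ℕ) : ℕ :=
  levelColoring p (fun i => s / p ^ i % p) (fun v => T.testBit v = true) (hash M p₀ a₀ x) l

theorem exists_two_pow (Q : ℕ) : ∃ r ≤ Q, Q ≤ 2 ^ r ∧ 2 ^ r ≤ 2 * Q + 1 := by
  induction Q with
  | zero => exact ⟨0, by simp⟩
  | succ Q ih =>
    obtain ⟨r, h1, h2, h3⟩ := ih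
    rcases h2.eq_or_lt with h | h
    · have : 0 < 2 ^ r := by positivity
      exact ⟨r + 1, by omega, by rw [pow_succ]; omega, by rw [pow_succ]; omega⟩
    · exact ⟨r, by omega, by omega, by omega⟩

theorem two_mul_add_three_mul_le (r : ℕ) : (2 * r + 3) * (r + 1) ≤ 8 * 2 ^ r := by
  induction r with
  | zero => simp
  | succ r ih =>
    rcases Nat.lt_or_ge r 2 with h | h
    · interval_cases r <;> norm_num
    · rw [pow_succ]
      nlinarith

/-- Two stages: the universe is first hashed into `2 * Q ^ 2 + 1` values, injectively on `W`, and
then colored by levels. After the first stage the multipliers have only O(log `Q`) bits on each of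
O(log `Q`) levels, so the number of seeds `s` is exponential in `Q` and does not involve `n`. -/
theorem exists_coloring (n Q : ℕ) (W : Finset ℕ) (hW : ∀ x ∈ W, x < n) (hQ : W.card ≤ Q) :
    ∃ p₀ < 2 * n + 3, ∃ a₀ < 2 * n + 3, ∃ p < 4 * Q ^ 2 + 3, ∃ s < 2 ^ (16 * Q + 8),
      ∃ T < 2 ^ (16 * Q + 8), ∃ l < Q + 2,
        Set.InjOn (coloring (2 * Q ^ 2 + 1) p₀ a₀ p s T l) W ∧
        ∀ x, coloring (2 * Q ^ 2 + 1) p₀ a₀ p s T l x < 16 * Q + 8 := by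
  obtain ⟨p₀, hp₀, h1, h2⟩ := Nat.exists_prime_lt_and_le_two_mul (n + 1) (by omega)
  obtain ⟨p, hp, h3, h4⟩ := Nat.exists_prime_lt_and_le_two_mul (2 * Q ^ 2 + 1) (by omega)
  obtain ⟨a₀, ha₀, hcoll⟩ := exists_hash hp₀ (2 * Q ^ 2 + 1) W fun x hx => by
    have := hW x hx
    omega
  have hinj₀ : Set.InjOn (hash (2 * Q ^ 2 + 1) p₀ a₀) W := by
    intro x hx y hy hxy
    by_contra hne
    have : 0 < (W.offDiag.filter fun q => hash (2 * Q ^ 2 + 1) p₀ a₀ q.1 =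
        hash (2 * Q ^ 2 + 1) p₀ a₀ q.2).card :=
      card_pos.2 ⟨(x, y), mem_filter.2 ⟨mem_offDiag.2 ⟨hx, hy, hne⟩, hxy⟩⟩
    -- The number of collisions times `2 * Q ^ 2 + 1` is at most `2 * Q ^ 2`, so there are none.
    have := Nat.pow_le_pow_left hQ 2
    nlinarith
  obtain ⟨r, hr1, hr2, hr3⟩ := exists_two_pow Q
  obtain ⟨a, T, ha, hT, hinj⟩ := exists_levelColoring hp (r + 1)
    (W.image (hash (2 * Q ^ 2 + 1) p₀ a₀)) (by
      intro y hy
      obtain ⟨x, _, rfl⟩ := mem_image.1 hy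
      exact (Nat.mod_lt _ (by omega)).trans h3)
    (by
      have : (W.image (hash (2 * Q ^ 2 + 1) p₀ a₀)).card ≤ W.card := card_image_le
      rw [pow_succ 2 r]
      omega)
  obtain ⟨s, hs, hsa⟩ := exists_digits (r + 1) a ha
  have hc : 2 ^ (r + 1 + 2) ≤ 16 * Q + 8 := by
    rw [show r + 1 + 2 = r + 3 by omega, pow_add]
    omega
  obtain ⟨T', hT', hbits⟩ := exists_bits_eq (hT.trans (range_subset_range.2 hc))
  have hcol : ∀ x, coloring (2 * Q ^ 2 + 1) p₀ a₀ p s T' (r + 1) x =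
      levelColoring p a (· ∈ T) (hash (2 * Q ^ 2 + 1) p₀ a₀ x) (r + 1) := fun x =>
    levelColoring_congr _ hsa (fun v _ => by rw [← hbits, mem_bits hT']) _
  refine ⟨p₀, by omega, a₀, by omega, p, by omega, s, hs.trans_le ?_, T', hT', r + 1, by omega,
    fun x hx y hy hxy => ?_, fun x => ?_⟩
  · have hp' : p ≤ 2 ^ (2 * r + 3) := by
      have := Nat.pow_le_pow_left hr2 2
      have h1 : 1 ≤ (2 ^ r) ^ 2 := Nat.one_le_pow _ _ (by positivity)
      rw [show 2 * r + 3 = r * 2 + 3 by ring, pow_add, pow_mul]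
      omega
    refine (Nat.pow_le_pow_left hp' _).trans ?_
    rw [← pow_mul]
    refine Nat.pow_le_pow_right (by omega) ?_
    have := two_mul_add_three_mul_le r
    omega
  · rw [hcol, hcol] at hxy
    exact hinj₀ hx hy (hinj (mem_coe.2 (mem_image_of_mem _ hx)) (mem_coe.2 (mem_image_of_mem _ hy))
      hxy)
  · rw [hcol]
    exact (levelColoring_lt _ _ _ _ _).trans_le hc

/-! ### The algorithm -/

/-- The instances of the problem. -/
structure Inst where
  t : ℕ
  k : ℕ
  n : ℕ
  L : List (Finset (Fin n))
  one_le : 1 ≤ t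
  nodup : L.Nodup
  uniform : SetCover.IsUniform t L.toFinset

/-- The numbers that determine a coloring. -/
structure Seed where
  p₀ : ℕ
  a₀ : ℕ
  p : ℕ
  s : ℕ
  T : ℕ
  l : ℕ

namespace Inst

variable (I : Inst)

/-- The incidence matrix. -/
def orc : ℕ → ℕ := (SetCover.input I.t I.k I.n I.L).arr 0

/-- A bound on the number of elements that have to be colored. -/
def Q : ℕ := I.t * (I.t + 1) * I.k

/-- The number of colors. -/
def c : ℕ := 16 * I.Q + 8

/-- A number of sets that suffices for a surplus. -/
def cap : ℕ := 2 ^ (I.c + I.t) * (I.n + 1) ^ I.t + 1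

/-- The number of sets that are considered. -/
def m : ℕ := min I.L.length I.cap

/-- The surplus that is needed. -/
def D : ℕ := I.n - I.t * ((I.n + I.t - 1) / I.t - I.k)

/-- The bound in terms of which the running time is measured. -/
def bd : ℕ := 2 ^ (I.c + I.t) * (I.n + 1) ^ (I.t + 1)

/-- The color of an element. -/
def color (σ : Seed) (x : ℕ) : ℕ :=
  coloring (2 * I.Q ^ 2 + 1) σ.p₀ σ.a₀ σ.p σ.s σ.T σ.l x

/-- The colors of the elements of a set. -/
def colorSet (σ : Seed) (s : ℕ) : Finset ℕ :=
  ((range I.n).filter fun x => I.orc (s * I.n + x) ≠ 0).image (I.color σ)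

/-- Some `j` sets have all the colors in the set coded by `C`, which is large. -/
def Test (σ : Seed) (j C : ℕ) : Prop :=
  I.D + I.t * j ≤ (bits I.c C).card ∧
    parityTerm (I.colorSet σ) I.m j I.c 1 C < parityTerm (I.colorSet σ) I.m j I.c 0 C

/-- The answer of the algorithm. -/
def Accepts : Prop :=
  (I.n < I.t ∧ I.k = 0 ∧ (I.n = 0 ∨ ∃ s < I.m, ∀ x < I.n, I.orc (s * I.n + x) ≠ 0)) ∨
  (I.t ≤ I.n ∧ ∃ p₀ < 2 * I.n + 3, ∃ a₀ < 2 * I.n + 3, ∃ p < 4 * I.Q ^ 2 + 3, ∃ s < 2 ^ I.c,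
    ∃ T < 2 ^ I.c, ∃ l < I.Q + 2, ∃ j < I.t * I.k + 1, ∃ C < 2 ^ I.c,
      I.Test ⟨p₀, a₀, p, s, T, l⟩ j C)

theorem le_bd {a b : ℕ} (ha : a ≤ I.c + I.t) (hb : b ≤ I.t + 1) :
    2 ^ a * (I.n + 1) ^ b ≤ I.bd :=
  Nat.mul_le_mul (Nat.pow_le_pow_right (by omega) ha) (Nat.pow_le_pow_right (by omega) hb)

theorem n_le_bd : I.n ≤ I.bd := by
  have := I.le_bd (a := 0) (b := 1) (by omega) (by omega)
  rw [pow_zero, pow_one] at this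
  omega

theorem two_pow_c_le_bd : 2 ^ I.c ≤ I.bd := by
  simpa using I.le_bd (a := I.c) (b := 0) (by omega) (by omega)

theorem c_le_bd : I.c ≤ I.bd := Nat.lt_two_pow_self.le.trans I.two_pow_c_le_bd

theorem Q_le_bd : I.Q ≤ I.bd := (show I.Q ≤ I.c by rw [c]; omega).trans I.c_le_bd

theorem t_le_bd : I.t ≤ I.bd := by
  have := I.le_bd (a := I.t) (b := 0) (by omega) (by omega)
  rw [pow_zero, mul_one] at this
  have := Nat.lt_two_pow_self (n := I.t)
  omega

theorem k_le_bd : I.k ≤ I.bd := by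
  refine le_trans ?_ I.Q_le_bd
  rw [Q]
  exact Nat.le_mul_of_pos_left _ (Nat.mul_pos I.one_le (by omega))

theorem cap_le : I.cap ≤ I.bd + 1 := by
  have := I.le_bd (a := I.c + I.t) (b := I.t) le_rfl (by omega)
  rw [cap]
  omega

end Inst

/-! ### Computability of the acceptance condition -/

namespace Ctx

variable {Γ : Type} {c : Ctx Γ} {ι : Γ → Inst} {σ : Γ → Seed}

/-- `f` is computable in polynomial time and has polynomially bounded values. -/
structure Small (c : Ctx Γ) (f : Γ → ℕ) : Prop where
  comp : c.Comp f
  poly : c.Poly f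

theorem Small.weak {f : Γ → ℕ} {R} (hf : c.Small f) : (c.push R).Small fun p => f p.1 :=
  ⟨hf.comp.weak, hf.poly.weak⟩

theorem Small.idx {b : Γ → ℕ} (hb : c.Poly b) : (c.idx b).Small fun p => p.2 :=
  ⟨Comp.top, hb.idx⟩

theorem Small.const (a : ℕ) : c.Small fun _ => a := ⟨.const a, .const a⟩

theorem Small.add {f g : Γ → ℕ} (hf : c.Small f) (hg : c.Small g) :
    c.Small fun γ => f γ + g γ := ⟨hf.comp.add hg.comp, hf.poly.add hg.poly⟩

theorem Small.sub {f g : Γ → ℕ} (hf : c.Small f) (hg : c.Comp g) :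
    c.Small fun γ => f γ - g γ := ⟨hf.comp.sub hg, hf.poly.mono fun _ _ => Nat.sub_le _ _⟩

theorem Small.mul {f g : Γ → ℕ} (hf : c.Small f) (hg : c.Small g) :
    c.Small fun γ => f γ * g γ := ⟨hf.comp.mul hf.poly hg.comp, hf.poly.mul hg.poly⟩

theorem Small.div {f g : Γ → ℕ} (hf : c.Small f) (hg : c.Comp g) :
    c.Small fun γ => f γ / g γ :=
  ⟨hf.comp.div hf.poly hg, hf.poly.mono fun _ _ => Nat.div_le_self _ _⟩

theorem Small.mod {f g : Γ → ℕ} (hf : c.Small f) (hg : c.Comp g) :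
    c.Small fun γ => f γ % g γ :=
  ⟨hf.comp.mod hf.poly hg, hf.poly.mono fun _ _ => Nat.mod_le _ _⟩

theorem Small.sq {f : Γ → ℕ} (hf : c.Small f) : c.Small fun γ => f γ ^ 2 := by
  simp only [pow_two]
  exact hf.mul hf

/-- The seed can be computed and is polynomially bounded. -/
structure SmallSeed (c : Ctx Γ) (σ : Γ → Seed) : Prop where
  p₀ : c.Small fun γ => (σ γ).p₀
  a₀ : c.Small fun γ => (σ γ).a₀
  p : c.Small fun γ => (σ γ).p
  s : c.Small fun γ => (σ γ).s
  T : c.Small fun γ => (σ γ).T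
  l : c.Small fun γ => (σ γ).l
  -- Needed because the colors, and the ranges of the hash functions, grow like `2 ^ l`.
  two_pow : c.Poly fun γ => 2 ^ (σ γ).l

theorem SmallSeed.weak {R} (h : c.SmallSeed σ) : (c.push R).SmallSeed fun p => σ p.1 :=
  ⟨h.p₀.weak, h.a₀.weak, h.p.weak, h.s.weak, h.T.weak, h.l.weak, h.two_pow.weak⟩

/-- The instance can be accessed. -/
structure Reads (c : Ctx Γ) (ι : Γ → Inst) : Prop where
  n : c.Comp fun γ => (ι γ).n
  t : c.Comp fun γ => (ι γ).t
  k : c.Comp fun γ => (ι γ).k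
  len : c.Comp fun γ => (ι γ).L.length
  orc : ∀ γ, c.orc γ = (ι γ).orc
  bd : ∀ γ, c.bd γ = (ι γ).bd

namespace Reads

theorem weak {R} (h : c.Reads ι) : (c.push R).Reads fun p => ι p.1 :=
  ⟨h.n.weak, h.t.weak, h.k.weak, h.len.weak, fun p => h.orc p.1, fun p => h.bd p.1⟩

theorem poly {f : Γ → ℕ} (h : c.Reads ι) (hf : ∀ γ, f γ ≤ (ι γ).bd) : c.Poly f :=
  Poly.bd.mono fun γ _ => (hf γ).trans (h.bd γ).ge

theorem small_n (h : c.Reads ι) : c.Small fun γ => (ι γ).n :=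
  ⟨h.n, h.poly fun γ => (ι γ).n_le_bd⟩

theorem small_t (h : c.Reads ι) : c.Small fun γ => (ι γ).t :=
  ⟨h.t, h.poly fun γ => (ι γ).t_le_bd⟩

theorem small_k (h : c.Reads ι) : c.Small fun γ => (ι γ).k :=
  ⟨h.k, h.poly fun γ => (ι γ).k_le_bd⟩

theorem small_Q (h : c.Reads ι) : c.Small fun γ => (ι γ).Q :=
  (h.small_t.mul (h.small_t.add (.const 1))).mul h.small_k

theorem small_c (h : c.Reads ι) : c.Small fun γ => (ι γ).c :=
  ((Small.const 16).mul h.small_Q).add (.const 8)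

theorem small_two_pow_c (h : c.Reads ι) : c.Small fun γ => 2 ^ (ι γ).c :=
  ⟨(Comp.const 2).pow (.const 2) h.small_c.comp h.small_c.poly,
    h.poly fun γ => (ι γ).two_pow_c_le_bd⟩

theorem small_cap (h : c.Reads ι) : c.Small fun γ => (ι γ).cap := by
  refine ⟨(Comp.mul ((Comp.const 2).pow (.const 2) (h.small_c.add h.small_t).comp
    (h.small_c.add h.small_t).poly) (h.poly fun γ => ?_)
    ((h.small_n.add (.const 1)).comp.pow (h.small_n.add (.const 1)).poly h.t h.small_t.poly)).add
      (.const 1), ((h.poly fun _ => le_rfl).add (.const 1)).mono fun γ _ => (ι γ).cap_le⟩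
  simpa using (ι γ).le_bd (a := (ι γ).c + (ι γ).t) (b := 0) le_rfl (by omega)

/-- The length of the list may be exponential in `n` and is never used as a loop bound; the minimum
is obtained by two truncated subtractions. -/
theorem small_m (h : c.Reads ι) : c.Small fun γ => (ι γ).m :=
  ⟨(h.len.sub (h.len.sub h.small_cap.comp)).congr fun γ _ => by rw [Inst.m]; omega,
    h.small_cap.poly.mono fun _ _ => min_le_right _ _⟩

theorem small_D (h : c.Reads ι) : c.Small fun γ => (ι γ).D :=
  h.small_n.sub (h.small_t.mul ((((h.small_n.add h.small_t).sub (.const 1)).div h.t).sub h.k)).comp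

/-- The test for incidence. -/
theorem dec_mem (h : c.Reads ι) {s x : Γ → ℕ} (hs : c.Small s) (hx : c.Comp x) :
    c.Dec fun γ => (ι γ).orc (s γ * (ι γ).n + x γ) ≠ 0 :=
  (((hs.mul h.small_n).comp.add hx).load.eqZero.not).congr fun γ _ => by rw [h.orc γ]

end Reads

theorem Small.hash {m p a x : Γ → ℕ} (hm : c.Comp m) (hp : c.Comp p) (ha : c.Small a)
    (hx : c.Small x) : c.Small fun γ => hash (m γ) (p γ) (a γ) (x γ) :=
  ((ha.mul hx).mod hp).mod hm

theorem Comp.levelColoring {p s T y l : Γ → ℕ} (hp : c.Small p) (hs : c.Small s) (hT : c.Small T)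
    (hy : c.Small y) (hl : c.Small l) (hl' : c.Poly fun γ => 2 ^ l γ) :
    c.Comp fun γ => levelColoring (p γ) (fun i => s γ / p γ ^ i % p γ)
      (fun v => (T γ).testBit v = true) (y γ) (l γ) := by
  have hi : (c.idx l).Small fun x => x.2 := .idx hl.poly
  have hi2 : (c.idx l).Small fun x => 2 ^ (x.2 + 2) := by
    refine ⟨(Comp.const 2).pow (.const 2) (hi.add (.const 2)).comp (hi.add (.const 2)).poly,
      (hl'.weak.mul (.const 4)).mono fun x hx => ?_⟩
    rw [pow_add]
    exact Nat.mul_le_mul (Nat.pow_le_pow_right (by omega) hx.2.le) le_rfl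
  have hlc : (c.idx l).Small fun x =>
      levelColor (p x.1) (fun i => s x.1 / p x.1 ^ i % p x.1) (y x.1) x.2 :=
    hi2.add (.hash hi2.comp hp.weak.comp
      ((hs.weak.div (hp.weak.comp.pow hp.weak.poly hi.comp hi.poly)).mod hp.weak.comp) hy.weak)
  refine (Comp.iter (z := fun _ => 0) (g := fun γ i a =>
      if (T γ).testBit (levelColor (p γ) (fun i => s γ / p γ ^ i % p γ) (y γ) i) = true then
        levelColor (p γ) (fun i => s γ / p γ ^ i % p γ) (y γ) i else a)
    hl.comp hl.poly (.const 0) ?_).congr fun γ _ => ?_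
  · refine (Comp.ite (hT.weak.comp.bit hT.weak.poly hlc.comp hlc.poly).weak hlc.weak.comp
      .top).congr fun _ _ => ?_
    congr
  · induction l γ with
    | zero => rfl
    | succ i ih => simp only [UniformSetCover.levelColoring, ← ih]

theorem SmallSeed.poly_color (hσ : c.SmallSeed σ) {x : Γ → ℕ} :
    c.Poly fun γ => (ι γ).color (σ γ) (x γ) :=
  (hσ.two_pow.mul (.const 4)).mono fun γ _ => by
    have := levelColoring_lt (σ γ).p (fun i => (σ γ).s / (σ γ).p ^ i % (σ γ).p)
      (fun v => (σ γ).T.testBit v = true)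
      (UniformSetCover.hash (2 * (ι γ).Q ^ 2 + 1) (σ γ).p₀ (σ γ).a₀ (x γ)) (σ γ).l
    rw [pow_add] at this
    exact this.le

namespace Reads

theorem comp_color (h : c.Reads ι) (hσ : c.SmallSeed σ) {x : Γ → ℕ} (hx : c.Small x) :
    c.Comp fun γ => (ι γ).color (σ γ) (x γ) :=
  .levelColoring hσ.p hσ.s hσ.T
    (.hash (((Small.const 2).mul h.small_Q.sq).add (.const 1)).comp hσ.p₀.comp hσ.a₀ hx)
    hσ.l hσ.two_pow

theorem comp_avoiding (h : c.Reads ι) (hσ : c.SmallSeed σ) {Z : Γ → ℕ} (hZ : c.Small Z) :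
    c.Comp fun γ => avoiding ((ι γ).colorSet (σ γ)) (ι γ).m (Z γ) := by
  classical
  have hs : (c.idx fun γ => (ι γ).m).Small fun x => x.2 := .idx h.small_m.poly
  have hx : ((c.idx fun γ => (ι γ).m).idx fun x => (ι x.1).n).Small fun x => x.2 :=
    .idx h.weak.small_n.poly
  refine (Dec.count (p := fun γ s => ∀ x < (ι γ).n, (ι γ).orc (s * (ι γ).n + x) ≠ 0 →
    ¬ (Z γ).testBit ((ι γ).color (σ γ) x) = true) h.small_m.comp h.small_m.poly
    (Dec.all h.weak.n h.weak.small_n.poly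
      ((h.weak.weak.dec_mem hs.weak hx.comp).imp (Dec.not
        (hZ.weak.weak.comp.bit hZ.weak.weak.poly (h.weak.weak.comp_color hσ.weak.weak hx)
          hσ.weak.weak.poly_color))))).congr fun γ _ => ?_
  rw [avoiding]
  refine congrArg card ?_
  ext s
  simp only [mem_filter]
  refine and_congr Iff.rfl ?_
  simp only [Inst.colorSet, mem_image, mem_filter, mem_range, forall_exists_index, and_imp]
  exact ⟨fun H _ x hx hm hv => hv ▸ H x hx hm, fun H x hx hm => H _ x hx hm rfl⟩

theorem comp_card_bits (h : c.Reads ι) {C : Γ → ℕ} (hC : c.Small C) :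
    c.Comp fun γ => (bits (ι γ).c (C γ)).card := by
  have hi : (c.idx fun γ => (ι γ).c).Small fun x => x.2 := .idx h.small_c.poly
  refine (Dec.count (p := fun γ i => (C γ).testBit i = true) h.small_c.comp h.small_c.poly
    (hC.weak.comp.bit hC.weak.poly hi.comp hi.poly)).congr fun γ _ => ?_
  rw [bits]
  congr

theorem comp_parityTerm (h : c.Reads ι) (hσ : c.SmallSeed σ) {j C : Γ → ℕ} (hj : c.Small j)
    (hC : c.Small C) (e : ℕ) :
    c.Comp fun γ => parityTerm ((ι γ).colorSet (σ γ)) (ι γ).m (j γ) (ι γ).c e (C γ) := by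
  classical
  have hZ : (c.idx fun γ => 2 ^ (ι γ).c).Small fun x => x.2 := .idx h.small_two_pow_c.poly
  have hi : ((c.idx fun γ => 2 ^ (ι γ).c).idx fun x => (ι x.1).c).Small fun x => x.2 :=
    .idx h.weak.small_c.poly
  have hbits : (c.idx fun γ => 2 ^ (ι γ).c).Small fun x => (bits (ι x.1).c x.2).card :=
    ⟨h.weak.comp_card_bits hZ, h.weak.small_c.poly.mono fun x _ =>
      (card_filter_le _ _).trans (card_range _).le⟩
  refine (Comp.sum (g := fun γ Z => if (∀ i < (ι γ).c, Z.testBit i = true →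
    (C γ).testBit i = true) ∧ (bits (ι γ).c Z).card % 2 = e then
      avoiding ((ι γ).colorSet (σ γ)) (ι γ).m Z ^ j γ else 0)
    h.small_two_pow_c.comp h.small_two_pow_c.poly ((Comp.ite (Dec.and (Dec.all
      (p := fun x i => x.2.testBit i = true → (C x.1).testBit i = true)
      h.weak.small_c.comp h.weak.small_c.poly
      ((hZ.weak.comp.bit hZ.weak.poly hi.comp hi.poly).imp
        (hC.weak.weak.comp.bit hC.weak.weak.poly hi.comp hi.poly)))
      ((hbits.mod (.const 2)).comp.eq (.const e)))
      (Comp.pow (h.weak.comp_avoiding hσ.weak hZ) (h.weak.small_m.poly.mono fun x _ =>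
        (card_filter_le _ _).trans (card_range _).le) hj.weak.comp hj.weak.poly)
      (.const 0)).congr fun x _ => ?_)).congr fun γ _ => ?_
  · congr
  · rw [parityTerm]

theorem dec_test (h : c.Reads ι) (hσ : c.SmallSeed σ) {j C : Γ → ℕ} (hj : c.Small j)
    (hC : c.Small C) : c.Dec fun γ => (ι γ).Test (σ γ) (j γ) (C γ) :=
  ((h.small_D.add (h.small_t.mul hj)).comp.le (h.comp_card_bits hC)).and
    ((h.comp_parityTerm hσ hj hC 1).lt (h.comp_parityTerm hσ hj hC 0))

theorem dec_test_ex (h : c.Reads ι) (hσ : c.SmallSeed σ) :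
    c.Dec fun γ => ∃ j < (ι γ).t * (ι γ).k + 1, ∃ C < 2 ^ (ι γ).c, (ι γ).Test (σ γ) j C := by
  have hb := (h.small_t.mul h.small_k).add (.const 1)
  exact Dec.ex hb.comp hb.poly (Dec.ex h.weak.small_two_pow_c.comp h.weak.small_two_pow_c.poly
    (h.weak.weak.dec_test hσ.weak.weak (Small.idx hb.poly).weak
      (.idx h.weak.small_two_pow_c.poly)))

theorem dec_level_ex (h : c.Reads ι) {p₀ a₀ p s T : Γ → ℕ} (hp₀ : c.Small p₀) (ha₀ : c.Small a₀)
    (hp : c.Small p) (hs : c.Small s) (hT : c.Small T) :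
    c.Dec fun γ => ∃ l < (ι γ).Q + 2, ∃ j < (ι γ).t * (ι γ).k + 1, ∃ C < 2 ^ (ι γ).c,
      (ι γ).Test ⟨p₀ γ, a₀ γ, p γ, s γ, T γ, l⟩ j C := by
  have hb := h.small_Q.add (.const 2)
  refine Dec.ex hb.comp hb.poly ?_
  have hσ : (c.idx fun γ => (ι γ).Q + 2).SmallSeed fun x =>
      ⟨p₀ x.1, a₀ x.1, p x.1, s x.1, T x.1, x.2⟩ :=
    ⟨hp₀.weak, ha₀.weak, hp.weak, hs.weak, hT.weak, .idx hb.poly,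
      h.weak.small_two_pow_c.poly.mono fun x hx => Nat.pow_le_pow_right (by omega) (by
        have : x.2 < (ι x.1).Q + 2 := hx.2
        simp only [Inst.c]
        omega)⟩
  exact h.weak.dec_test_ex hσ

theorem dec_seed_ex (h : c.Reads ι) {p₀ a₀ p : Γ → ℕ} (hp₀ : c.Small p₀) (ha₀ : c.Small a₀)
    (hp : c.Small p) :
    c.Dec fun γ => ∃ s < 2 ^ (ι γ).c, ∃ T < 2 ^ (ι γ).c, ∃ l < (ι γ).Q + 2,
      ∃ j < (ι γ).t * (ι γ).k + 1, ∃ C < 2 ^ (ι γ).c,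
        (ι γ).Test ⟨p₀ γ, a₀ γ, p γ, s, T, l⟩ j C :=
  Dec.ex h.small_two_pow_c.comp h.small_two_pow_c.poly
    (Dec.ex h.weak.small_two_pow_c.comp h.weak.small_two_pow_c.poly
      (h.weak.weak.dec_level_ex hp₀.weak.weak ha₀.weak.weak hp.weak.weak
        (Small.idx h.small_two_pow_c.poly).weak (.idx h.weak.small_two_pow_c.poly)))

theorem dec_accepts (h : c.Reads ι) : c.Dec fun γ => (ι γ).Accepts := by
  refine Dec.or ((h.n.lt h.t).and ((h.k.eqZero).and (h.n.eqZero.or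
    (Dec.ex h.small_m.comp h.small_m.poly (Dec.all h.weak.n h.weak.small_n.poly
      (h.weak.weak.dec_mem (Small.idx h.small_m.poly).weak .top)))))) ((h.t.le h.n).and ?_)
  have b₁ := ((Small.const 2).mul h.small_n).add (.const 3)
  have b₂ := ((Small.const 2).mul (h.weak (R := fun γ i => i < 2 * (ι γ).n + 3)).small_n).add (.const 3)
  have b₃ := ((Small.const 4).mul ((h.weak (R := fun γ i => i < 2 * (ι γ).n + 3)).weak
    (R := fun γ i => i < 2 * (ι γ.1).n + 3)).small_Q.sq).add (.const 3)
  exact Dec.ex b₁.comp b₁.poly (Dec.ex b₂.comp b₂.poly (Dec.ex b₃.comp b₃.poly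
    (h.weak.weak.weak.dec_seed_ex (Small.idx b₁.poly).weak.weak (Small.idx b₂.poly).weak
      (.idx b₃.poly))))

end Reads

end Ctx

/-! ### Correctness -/

namespace Inst

variable (I : Inst)

/-- The set number `s`. -/
def set (s : ℕ) : Finset (Fin I.n) := I.L.getD s ∅

theorem orc_ne_zero_iff {s : ℕ} (hs : s < I.L.length) (x : Fin I.n) :
    I.orc (s * I.n + x) ≠ 0 ↔ x ∈ I.set s := by
  simp only [orc, SetCover.input, set, List.getD_eq_getElem _ _ hs]
  have hx := x.2
  constructor
  · intro h
    split_ifs at h with h'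
    · obtain ⟨-, i, j, hij, hj⟩ := h'
      have hj2 := j.2
      have h1 : (s * I.n + x) / I.n = s := by
        rw [Nat.mul_comm, Nat.mul_add_div (by omega), Nat.div_eq_of_lt hx, Nat.add_zero]
      have h2 : (i * I.n + j) / I.n = i := by
        rw [Nat.mul_comm, Nat.mul_add_div (by omega), Nat.div_eq_of_lt hj2, Nat.add_zero]
      have hi : s = i := by rw [← h1, hij, h2]
      subst hi
      have : x = j := Fin.ext (by omega)
      rwa [this]
    · simp at h
  · intro h
    rw [if_pos ⟨trivial, ⟨s, hs⟩, x, rfl, h⟩]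
    simp

theorem colorSet_eq {s : ℕ} (hs : s < I.L.length) (σ : Seed) :
    I.colorSet σ s = (I.set s).image fun x : Fin I.n => I.color σ x := by
  ext v
  simp only [colorSet, mem_image, mem_filter, mem_range]
  constructor
  · rintro ⟨x, ⟨hx, h⟩, rfl⟩
    exact ⟨⟨x, hx⟩, (I.orc_ne_zero_iff hs ⟨x, hx⟩).1 h, rfl⟩
  · rintro ⟨x, hx, rfl⟩
    exact ⟨x, ⟨x.2, (I.orc_ne_zero_iff hs x).2 hx⟩, rfl⟩

theorem m_le_length : I.m ≤ I.L.length := min_le_left _ _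

theorem set_mem {s : ℕ} (hs : s < I.m) : I.set s ∈ (I.L.take I.m).toFinset := by
  have := hs.trans_le I.m_le_length
  rw [set, List.getD_eq_getElem _ _ this, List.mem_toFinset, List.mem_take_iff_getElem]
  exact ⟨s, by omega, rfl⟩

theorem exists_set_eq {A : Finset (Fin I.n)} (hA : A ∈ (I.L.take I.m).toFinset) :
    ∃ s < I.m, I.set s = A := by
  rw [List.mem_toFinset, List.mem_take_iff_getElem] at hA
  obtain ⟨s, hs, rfl⟩ := hA
  exact ⟨s, by omega, List.getD_eq_getElem _ _ _⟩

theorem n_le : I.n ≤ I.t * ((I.n + I.t - 1) / I.t) := by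
  have := Nat.lt_mul_div_succ (I.n + I.t - 1) I.one_le
  have := I.one_le
  rw [Nat.mul_add] at *
  omega

theorem D_le : I.D ≤ I.t * I.k := by
  have h1 := I.n_le
  have h2 := Nat.mul_le_mul_left I.t
    (show (I.n + I.t - 1) / I.t ≤ ((I.n + I.t - 1) / I.t - I.k) + I.k by omega)
  rw [Nat.mul_add] at h2
  rw [D]
  omega

theorem D_add_mul_le {j : ℕ} (hj : j ≤ I.D) : I.D + I.t * j ≤ I.Q := by
  have h1 := I.D_le
  have h2 := Nat.mul_le_mul_left I.t (hj.trans h1)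
  rw [Q]
  nlinarith

/-- A surplus is already attained by the sets that are considered. -/
theorem hasSurplus_take (h : HasSurplus I.t I.D I.L.toFinset) :
    HasSurplus I.t I.D (I.L.take I.m).toFinset := by
  rcases le_total I.L.length I.cap with hle | hle
  · rwa [m, min_eq_left hle, List.take_length]
  · by_contra hn
    have h1 := card_le_of_not_hasSurplus hn
    rw [List.toFinset_card_of_nodup (I.nodup.sublist (List.take_sublist _ _)), List.length_take,
      min_eq_left I.m_le_length, m, min_eq_right hle, cap, Fintype.card_fin] at h1
    -- A truncated list has exactly `cap` distinct sets, more than a family without surplus can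
    -- have.
    have h2 := Nat.mul_le_mul_right ((I.n + 1) ^ I.t) (Nat.pow_le_pow_right (show 0 < 2 by omega)
      (show I.D + I.t * I.D ≤ I.c + I.t by have := I.D_add_mul_le le_rfl; rw [c]; omega))
    omega

/-- A union has at least as many elements as colors, and repetitions in the tuple only reduce the
number of sets; no property of the coloring is needed. -/
theorem hasSurplus_of_test {σ : Seed} {j C : ℕ} (h : I.Test σ j C) :
    HasSurplus I.t I.D I.L.toFinset := by
  obtain ⟨h1, h2⟩ := h
  obtain ⟨τ, hτ, hC⟩ := (parityTerm_lt_iff _ _ _ _ _).1 h2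
  have hτ' : ∀ i, τ i < I.L.length := fun i => (hτ i).trans_le I.m_le_length
  refine ⟨univ.image fun i => I.set (τ i), fun A hA => ?_, ?_⟩
  · obtain ⟨i, _, rfl⟩ := mem_image.1 hA
    have := I.set_mem (hτ i)
    rw [List.mem_toFinset] at this ⊢
    exact List.mem_of_mem_take this
  · have h3 : (univ.image fun i => I.set (τ i)).card ≤ j := by
      simpa using card_image_le (s := univ) (f := fun i : Fin j => I.set (τ i))
    have h4 : bits I.c C ⊆ ((univ.image fun i => I.set (τ i)).biUnion id).image
        fun x : Fin I.n => I.color σ x := by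
      refine hC.trans fun v hv => ?_
      obtain ⟨i, _, hv⟩ := mem_biUnion.1 hv
      rw [I.colorSet_eq (hτ' i)] at hv
      obtain ⟨x, hx, rfl⟩ := mem_image.1 hv
      exact mem_image_of_mem _ (mem_biUnion.2 ⟨_, mem_image_of_mem _ (mem_univ i), hx⟩)
    have h5 := (card_le_card h4).trans card_image_le
    have h6 := Nat.mul_le_mul_left I.t h3
    omega

/-- From a small surplus family `F`, exactly `D + t * F.card` elements of its union are kept. A
coloring injective on them makes their colors the required set `C`, and an enumeration of `F` is the
covering tuple. -/
theorem exists_test (h : HasSurplus I.t I.D I.L.toFinset) :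
    ∃ p₀ < 2 * I.n + 3, ∃ a₀ < 2 * I.n + 3, ∃ p < 4 * I.Q ^ 2 + 3, ∃ s < 2 ^ I.c,
      ∃ T < 2 ^ I.c, ∃ l < I.Q + 2, ∃ j < I.t * I.k + 1, ∃ C < 2 ^ I.c,
        I.Test ⟨p₀, a₀, p, s, T, l⟩ j C := by
  obtain ⟨F, hF, hFD, hD⟩ := (I.hasSurplus_take h).exists_card_le
  obtain ⟨W, hW, hWc⟩ := exists_subset_card_eq hD
  obtain ⟨p₀, hp₀, a₀, ha₀, p, hp, s, hs, T, hT, l, hl, hinj, hlt⟩ :=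
    exists_coloring I.n I.Q (W.map Fin.valEmbedding) (fun x hx => by
      obtain ⟨y, _, rfl⟩ := mem_map.1 hx
      exact y.2) (by rw [card_map, hWc]; exact I.D_add_mul_le hFD)
  let σ : Seed := ⟨p₀, a₀, p, s, T, l⟩
  obtain ⟨C, hC, hbits⟩ := exists_bits_eq (c := I.c)
    (s := (W.map Fin.valEmbedding).image (I.color σ)) fun v hv => by
      obtain ⟨x, _, rfl⟩ := mem_image.1 hv
      exact mem_range.2 (hlt x)
  refine ⟨p₀, hp₀, a₀, ha₀, p, hp, s, hs, T, hT, l, hl, F.card, by have := I.D_le; omega,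
    C, hC, ?_, ?_⟩
  · rw [hbits, card_image_of_injOn (f := I.color σ) hinj, card_map, hWc]
  · choose! ν hν hν' using fun A (hA : A ∈ F) => I.exists_set_eq (hF hA)
    refine (parityTerm_lt_iff _ _ _ _ _).2 ⟨fun i => ν (F.equivFin.symm i),
      fun i => hν _ (F.equivFin.symm i).2, fun v hv => ?_⟩
    rw [hbits] at hv
    obtain ⟨x, hx, rfl⟩ := mem_image.1 hv
    obtain ⟨y, hy, rfl⟩ := mem_map.1 hx
    obtain ⟨A, hA, hyA⟩ := mem_biUnion.1 (hW hy)
    refine mem_biUnion.2 ⟨F.equivFin ⟨A, hA⟩, mem_univ _, ?_⟩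
    simp only [Equiv.symm_apply_apply]
    rw [I.colorSet_eq ((hν A hA).trans_le I.m_le_length), hν' A hA]
    exact mem_image_of_mem (fun x : Fin I.n => I.color σ x) hyA

theorem ceil_eq : ⌈(I.n : ℚ) / (I.t : ℚ)⌉ = (((I.n + I.t - 1) / I.t : ℕ) : ℤ) := by
  have ht : (0 : ℚ) < I.t := by exact_mod_cast I.one_le
  have h1 := I.n_le
  have h2 := Nat.mul_div_le (I.n + I.t - 1) I.t
  have h3 := I.one_le
  rw [Int.ceil_eq_iff, lt_div_iff₀ ht, div_le_iff₀ ht]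
  generalize (I.n + I.t - 1) / I.t = r at *
  constructor
  · have : (I.t * r : ℚ) < I.n + I.t := by
      exact_mod_cast (show I.t * r < I.n + I.t by omega)
    push_cast
    linarith
  · rw [mul_comm]
    exact_mod_cast h1

theorem length_le : I.L.length ≤ 2 ^ I.n := by
  rw [← List.toFinset_card_of_nodup I.nodup]
  refine (card_le_univ _).trans ?_
  simp

theorem hasCover_iff_of_lt (hn : I.n < I.t) :
    SetCover.HasCover I.L.toFinset ((((I.n + I.t - 1) / I.t : ℕ) : ℤ) - I.k) ↔
      I.k = 0 ∧ (I.n = 0 ∨ ∃ s < I.m, ∀ x < I.n, I.orc (s * I.n + x) ≠ 0) := by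
  -- Here no truncation occurs: there are at most `2 ^ n` sets, and the summand `t` in the exponent
  -- of `cap` allows for `2 ^ t`.
  have hm : I.m = I.L.length := by
    refine min_eq_left (I.length_le.trans ((Nat.pow_le_pow_right (by omega) hn.le).trans ?_))
    have := I.le_bd (a := 0) (b := 0) (by omega) (by omega)
    have h1 : 2 ^ I.t ≤ 2 ^ (I.c + I.t) := Nat.pow_le_pow_right (by omega) (by omega)
    have h2 := Nat.mul_le_mul h1 (Nat.one_le_pow I.t (I.n + 1) (by omega))
    rw [cap]
    omega
  rcases Nat.eq_zero_or_pos I.n with h0 | h0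
  · have hr : (I.n + I.t - 1) / I.t = 0 := Nat.div_eq_of_lt (by omega)
    rw [hr]
    simp only [h0, true_or, and_true]
    constructor
    · rintro ⟨𝒞, _, _, h⟩
      omega
    · intro hk
      exact ⟨∅, by simp, fun u => absurd u.2 (by omega), by simp [hk]⟩
  -- For 0 < `n` < `t` one set at most is allowed and one at least is needed, so `k = 0` and some
  -- listed set is the whole universe.
  · have hr : (I.n + I.t - 1) / I.t = 1 :=
      Nat.div_eq_of_lt_le (by omega) (by omega)
    rw [hr, hm]
    constructor
    · rintro ⟨𝒞, h1, h2, h3⟩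
      obtain ⟨A, hA, -⟩ := h2 ⟨0, h0⟩
      have hpos := card_pos.2 ⟨A, hA⟩
      obtain ⟨s, hs, hsA⟩ := List.getElem_of_mem (List.mem_toFinset.1 (h1 hA))
      refine ⟨by omega, Or.inr ⟨s, hs, fun x hx => ?_⟩⟩
      rw [I.orc_ne_zero_iff hs ⟨x, hx⟩, set, List.getD_eq_getElem _ _ hs, hsA]
      obtain ⟨B, hB, hxB⟩ := h2 ⟨x, hx⟩
      rwa [card_le_one.1 (by omega) A hA B hB]
    · rintro ⟨hk, h | ⟨s, hs, h⟩⟩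
      · omega
      · refine ⟨{I.set s}, ?_, fun u => ⟨_, mem_singleton_self _,
          (I.orc_ne_zero_iff hs u).1 (h u u.2)⟩, by simp [hk]⟩
        rw [singleton_subset_iff, List.mem_toFinset, set, List.getD_eq_getElem _ _ hs]
        exact List.getElem_mem hs

theorem accepts_iff :
    I.Accepts ↔ SetCover.HasCover I.L.toFinset (⌈(I.n : ℚ) / (I.t : ℚ)⌉ - (I.k : ℤ)) := by
  rw [I.ceil_eq, Accepts]
  rcases Nat.lt_or_ge I.n I.t with h | h
  · rw [I.hasCover_iff_of_lt h]
    constructor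
    · rintro (⟨-, h'⟩ | ⟨h', -⟩)
      · exact h'
      · omega
    · exact fun h' => Or.inl ⟨h, h'⟩
  · rw [hasCover_iff_hasSurplus I.one_le (by simpa using h) I.uniform, Fintype.card_fin]
    constructor
    · rintro (⟨h', -⟩ | ⟨-, p₀, _, a₀, _, p, _, s, _, T, _, l, _, j, _, C, _, ht⟩)
      · omega
      · exact I.hasSurplus_of_test ht
    · exact fun h' => Or.inr ⟨h, I.exists_test h'⟩

/-- The running time in terms of `k` and `n`. -/
theorem time_le (E : ℕ) {C : ℕ}
    (hC : C = E * 2 ^ ((9 + I.t) * E) + 16 * I.t * (I.t + 1) * E + (I.t + 1) * E) :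
    E * (I.bd + 1) ^ E ≤ C * 2 ^ (C * I.k) * (I.n + 1) ^ C := by
  -- Since `bd` is positive, adding 1 at most doubles it; the 9 is the 8 in `c` plus this doubling.
  have h1 : I.bd + 1 ≤ 2 ^ (9 + I.t + 16 * I.t * (I.t + 1) * I.k) * (I.n + 1) ^ (I.t + 1) := by
    have : 1 ≤ I.bd := by simpa using I.le_bd (a := 0) (b := 0) (by omega) (by omega)
    rw [show 9 + I.t + 16 * I.t * (I.t + 1) * I.k = I.c + I.t + 1 by rw [c, Q]; ring, pow_succ 2]
    rw [bd] at *
    linarith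
  calc E * (I.bd + 1) ^ E
      ≤ E * (2 ^ (9 + I.t + 16 * I.t * (I.t + 1) * I.k) * (I.n + 1) ^ (I.t + 1)) ^ E := by gcongr
    _ = (E * 2 ^ ((9 + I.t) * E)) * 2 ^ (16 * I.t * (I.t + 1) * E * I.k) *
        (I.n + 1) ^ ((I.t + 1) * E) := by
      rw [mul_pow, ← pow_mul, ← pow_mul, mul_assoc E, ← pow_add]
      ring_nf
    _ ≤ C * 2 ^ (C * I.k) * (I.n + 1) ^ C := by
      refine Nat.mul_le_mul (Nat.mul_le_mul (by omega) (Nat.pow_le_pow_right (by omega)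
        (Nat.mul_le_mul_right _ (by omega)))) (Nat.pow_le_pow_right (by omega) (by omega))

end Inst

/-! ### The program on the given input -/

/-- The memory at the start of the computation. -/
def inputCtx : Ctx Inst where
  d := 4
  rep I := (SetCover.input I.t I.k I.n I.L).var
  orc I := I.orc
  bd I := I.bd
  ok _ := True

theorem reads_inputCtx : inputCtx.Reads fun I => I where
  n := Ctx.Comp.var (c := inputCtx) (i := 0) (by simp [inputCtx])
  t := Ctx.Comp.var (c := inputCtx) (i := 1) (by simp [inputCtx])
  k := Ctx.Comp.var (c := inputCtx) (i := 2) (by simp [inputCtx])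
  len := Ctx.Comp.var (c := inputCtx) (i := 3) (by simp [inputCtx])
  orc _ := rfl
  bd _ := rfl

end UniformSetCover

open UniformSetCover in
theorem mainTheorem4 :
    ∃ P : RAM.Prog, ∀ t : ℕ, 1 ≤ t → ∃ C : ℕ,
      ∀ (k n : ℕ) (L : List (Finset (Fin n))), L.Nodup → SetCover.IsUniform t L.toFinset →
        ∃ (s : RAM.State) (T : ℕ),
          RAM.Runs P (SetCover.input t k n L) s T ∧
          T ≤ C * 2 ^ (C * k) * (n + 1) ^ C ∧
          (s.var 0 = 1 ↔ SetCover.HasCover L.toFinset (⌈(n : ℚ) / (t : ℚ)⌉ - (k : ℤ))) := by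
  -- The input occupies registers 0 to 3, so the answer appears in register 4. Two more steps copy
  -- it to register 0 by adding a zero.
  obtain ⟨P, τ, hτ, H⟩ := reads_inputCtx.dec_accepts id 4 fun i hi => hi
  obtain ⟨E, hE⟩ := hτ.add (.const 2)
  refine ⟨.seq P (.seq (.const 5 0) (.add 0 4 5)), fun t ht =>
    ⟨E * 2 ^ ((9 + t) * E) + 16 * t * (t + 1) * E + (t + 1) * E, fun k n L hL hu => ?_⟩⟩
  let I : Inst := ⟨t, k, n, L, ht, hL, hu⟩
  obtain ⟨s, T, h1, h2, h3, -, -⟩ := H I (SetCover.input t k n L) trivial (fun _ _ => rfl) rfl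
  refine ⟨_, _, .seq h1 (.seq (.const s 5 0) (.add _ 0 4 5)), ?_, ?_⟩
  · exact le_trans (Nat.add_le_add_right h2 2) ((hE I trivial).trans (I.time_le E rfl))
  · rw [← I.accepts_iff]
    by_cases h : I.Accepts <;> simp [RAM.State.setVar, h3, h]
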